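/- **Setting.** For a real $h\in L^2(\mathbb R)$ let $\hat h(\omega)=\int h(t)e^{-i\omega t}\,dt$ and $G_h(\omega)=\bigl(\sum_{k\in\mathbb Z}|\hat h(\omega+2k\pi)|^2\bigr)^{1/2}$. Let $\lambda\in H^1(\mathbb R)$ be real-valued and continuous (its continuous representative), with $0<A\le G_\lambda\le B<\infty$ almost everywhere for some constants $A,B$ and $\operatorname{ess\,sup}_\omega G_{\lambda'}(\omega)/G_\lambda(\omega)<\infty$. Let $$V^2(\lambda)=\Bigl\{f(t)=\sum_{k\in\mathbb Z}c_k\lambda(t-k)\ :\ (c_k)\in\ell^2(\mathbb Z;\mathbb R)\Bigr\},\qquad \tau=\pi\cdot\operatorname*{ess\,inf}_\omega\frac{G_\lambda(\omega)}{G_{\lambda'}(\omega)} .$$ Let $S\subseteq V^2(\lambda)$ be a non-empty set of input signals (for instance $S=V^2(\lambda)$). A *time encoding machine* (TEM) on $S$ is a map $\mathcal T$ from $S$ to the strictly increasing real sequences $(t_n)_{n\in\mathbb Z}$ with $t_n\to\pm\infty$ as $n\to\pm\infty$. It is *$T$-dense* if $t_{n+1}-t_n\le T$ for all $n$ and all outputs,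 and *invertible* if there is a map $\mathcal D$ from such sequences to $S$ with $\mathcal D\circ\mathcal T=\mathrm{Id}_S$. It is an *integrate-and-fire TEM* with test functions $\{\Phi_n\}$ if, for every $f\in S$ with output $(t_n)=\mathcal Tf$ and every $n$, the function $\Phi_n:\mathbb R\to\mathbb R$ is determined by $n$ and the times $t_i$, $i\le n-1$, through a fixed rule, $\int_{t_{n-1}}^{t_n}f(u)\,du=\Phi_n(t_n)$, and $\int_{t_{n-1}}^{t}f(u)\,du\ne\Phi_n(t)$ for all $t\in\,]t_{n-1},t_n[$. **Theorem.** One has $0<\tau<\infty$, $V^2(\lambda)\subset L^2(\mathbb R)$, there is an orthogonal projector $P$ of $L^2(\mathbb R)$ onto $V^2(\lambda)$, and $V^2(\lambda)$ has a reproducing kernel: functions $K_x\in V^2(\lambda)$, $x\in\mathbb R$, with $f(x)=\langle f\mid K_x\rangle$ for all $f\in V^2(\lambda)$. For every $T<\tau$, every integrate-and-fire TEM $\mathcal T$ on $S$ which is $T$-dense is invertible. Moreover, let $f\in S$, $(t_n)=\mathcal Tf$, $s_n=(t_{n-1}+t_n)/2$ and $$Zg=\sum_{n\in\mathbb Z}\Bigl(\int_{t_n}^{t_{n+1}}g(u)\,du\Bigr)K_{s_{n+1}}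 .$$ This series converges unconditionally in $L^2(\mathbb R)$ for every $g\in V^2(\lambda)$, and $Zf=\sum_n\Phi_{n+1}(t_{n+1})\,K_{s_{n+1}}$ is determined by the output $(t_n)$. The iteration $$f_1=PZf,\qquad f_{k+1}=f_1+(\mathrm{Id}-PZ)f_k\quad(k\ge1)$$ satisfies $$\|f-f_k\|_{L^2}\le\Bigl(\frac T\tau\Bigr)^k\|f\|_{L^2}\quad(k\ge1),\qquad\text{hence } f_k\to f\text{ in }L^2(\mathbb R)\text{ as }k\to\infty .$$ -/

import Mathlib

open MeasureTheory Filter Topology FourierTransform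
open scoped ENNReal

noncomputable section

/-- A real function of `H¹(ℝ)`, given by its continuous representative (which exists because
`H¹(ℝ) ⊆ C(ℝ)`) together with its weak derivative (unique up to null sets). -/
structure SobolevH1 where
  /-- the continuous representative -/
  toFun : ℝ → ℝ
  /-- the weak derivative -/
  deriv : ℝ → ℝ
  continuous_toFun : Continuous toFun
  memLp_toFun : MemLp toFun 2 (volume : Measure ℝ)
  memLp_deriv : MemLp deriv 2 (volume : Measure ℝ)
  /-- integration by parts against test functions -/
  weak_deriv : ∀ φ : ℝ → ℝ, ContDiff ℝ (⊤ : ℕ∞) φ → HasCompactSupport φ →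
    ∫ x, toFun x * _root_.deriv φ x = - ∫ x, deriv x * φ x

/-- The `L²` (Plancherel) Fourier transform `ĥ(ω) = ∫ h(t) exp(-iωt) dt` of a real
square-integrable function, defined for almost every `ω`. Mathlib's transform has the kernel
`exp(-2πi t ξ)`, hence `ξ = ω / (2π)`. -/
def fourierL2 (h : ℝ → ℝ) (hh : MemLp h 2 (volume : Measure ℝ)) (ω : ℝ) : ℂ :=
  (𝓕 (hh.ofReal (K := ℂ)).toLp : Lp ℂ 2 (volume : Measure ℝ)) (ω / (2 * Real.pi))

/-- `G_h(ω) = (∑ₖ |ĥ(ω + 2kπ)|²)^{1/2}`, with values in `[0, ∞]`, defined for almost every `ω`. -/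
def gramSymbol (h : ℝ → ℝ) (hh : MemLp h 2 (volume : Measure ℝ)) (ω : ℝ) : ℝ≥0∞ :=
  (∑' k : ℤ, ‖fourierL2 h hh (ω + 2 * k * Real.pi)‖ₑ ^ 2) ^ (1 / 2 : ℝ)

namespace SobolevH1

/-- `G_λ`. -/
def G (lam : SobolevH1) : ℝ → ℝ≥0∞ := gramSymbol lam.toFun lam.memLp_toFun

/-- `G_{λ'}`. -/
def G' (lam : SobolevH1) : ℝ → ℝ≥0∞ := gramSymbol lam.deriv lam.memLp_deriv

/-- The class `E` of generators: `0 < A ≤ G_λ ≤ B < ∞` and `sup G_{λ'} / G_λ < ∞`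
(almost everywhere bounds, since Fourier transforms are defined almost everywhere). -/
structure IsGenerator (lam : SobolevH1) : Prop where
  bounds : ∃ A B : ℝ≥0∞, 0 < A ∧ B < ⊤ ∧ ∀ᵐ ω : ℝ, A ≤ lam.G ω ∧ lam.G ω ≤ B
  sup_lt_top : essSup (fun ω : ℝ => lam.G' ω / lam.G ω) volume < ⊤

/-- `τ = π · inf_ω G_λ(ω) / G_{λ'}(ω)`. -/
def tau (lam : SobolevH1) : ℝ≥0∞ :=
  ENNReal.ofReal Real.pi * essInf (fun ω : ℝ => lam.G ω / lam.G' ω) volume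

/-- The shift-invariant space `V²(λ)` of the functions `f(t) = ∑ₖ cₖ λ(t - k)` with
`c ∈ ℓ²(ℤ)`, as a space of functions defined at every point. -/
def V2 (lam : SobolevH1) : Submodule ℝ (ℝ → ℝ) where
  carrier := {f | ∃ c : lp (fun _ : ℤ => ℝ) 2,
    ∀ t : ℝ, HasSum (fun k : ℤ => c k * lam.toFun (t - k)) (f t)}
  zero_mem' := ⟨0, fun t => by simp⟩
  add_mem' := by
    rintro f g ⟨c, hc⟩ ⟨d, hd⟩
    refine ⟨c + d, fun t => ?_⟩
    simpa [add_mul] using (hc t).add (hd t)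
  smul_mem' := by
    rintro a f ⟨c, hc⟩
    refine ⟨a • c, fun t => ?_⟩
    simpa [mul_assoc] using (hc t).mul_left a

/-- `V²(λ)` as a subspace of the Hilbert space `L²(ℝ)`. -/
def V2L (lam : SobolevH1) : Submodule ℝ (Lp ℝ 2 (volume : Measure ℝ)) where
  carrier := {F | ∃ f ∈ lam.V2, (F : ℝ → ℝ) =ᵐ[volume] f}
  zero_mem' := ⟨0, lam.V2.zero_mem, Lp.coeFn_zero ℝ 2 volume⟩
  add_mem' := by
    rintro F G ⟨f, hf, hFf⟩ ⟨g, hg, hGg⟩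
    exact ⟨f + g, lam.V2.add_mem hf hg, (Lp.coeFn_add F G).trans (hFf.add hGg)⟩
  smul_mem' := by
    rintro a F ⟨f, hf, hFf⟩
    exact ⟨a • f, lam.V2.smul_mem a hf, (Lp.coeFn_smul a F).trans (hFf.const_smul a)⟩

/-- `K` is the reproducing kernel of `V²(λ)`: `Kₓ ∈ V²(λ)` and `f(x) = ⟨f, Kₓ⟩` for all
`f ∈ V²(λ)`. It is unique. -/
def IsReproducingKernel (lam : SobolevH1) (K : ℝ → Lp ℝ 2 (volume : Measure ℝ)) : Prop :=
  ∀ x : ℝ, K x ∈ lam.V2L ∧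
    ∀ f ∈ lam.V2, ∀ F : Lp ℝ 2 (volume : Measure ℝ), (F : ℝ → ℝ) =ᵐ[volume] f →
      f x = inner ℝ F (K x)

end SobolevH1

/-- Bi-infinite sequences of times `… < tₙ < tₙ₊₁ < …` with `tₙ → ±∞` as `n → ±∞`. -/
structure TimeSeq where
  /-- the `n`-th time -/
  t : ℤ → ℝ
  strictMono : StrictMono t
  tendsto_atTop : Tendsto t atTop atTop
  tendsto_atBot : Tendsto t atBot atBot

namespace TimeSeq

/-- The midpoint `sₙ = (tₙ₋₁ + tₙ) / 2`. -/
def s (σ : TimeSeq) (n : ℤ) : ℝ := (σ.t (n - 1) + σ.t n) / 2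

/-- The times `tᵢ`, `i ≤ n - 1`. -/
def past (σ : TimeSeq) (n : ℤ) : Set.Iic (n - 1) → ℝ := fun i => σ.t i

/-- `T`-density: `tₙ₊₁ - tₙ ≤ T` for all `n`. -/
def IsDense (σ : TimeSeq) (T : ℝ) : Prop := ∀ n : ℤ, σ.t (n + 1) - σ.t n ≤ T

/-- The operator `Z f = ∑ₙ (∫_{tₙ}^{tₙ₊₁} f) K_{sₙ₊₁}`, the series being taken in `L²(ℝ)`. -/
def Z (σ : TimeSeq) (K : ℝ → Lp ℝ 2 (volume : Measure ℝ))
    (F : Lp ℝ 2 (volume : Measure ℝ)) : Lp ℝ 2 (volume : Measure ℝ) :=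
  ∑' n : ℤ, (∫ u in σ.t n..σ.t (n + 1), F u) • K (σ.s (n + 1))

end TimeSeq

/-- A time encoding machine on a set `S` of real functions. -/
abbrev TEM (S : Set (ℝ → ℝ)) := S → TimeSeq

/-- A rule giving the `n`-th test function `Φₙ : ℝ → ℝ` from the times `tᵢ`, `i ≤ n - 1`. -/
abbrev TestRule := (n : ℤ) → (Set.Iic (n - 1) → ℝ) → ℝ → ℝ

namespace TEM

variable {S : Set (ℝ → ℝ)}

/-- Invertibility: there is a time decoding machine `D` with `D ∘ 𝒯 = id`. -/
def IsInvertible (𝒯 : TEM S) : Prop := ∃ D : TimeSeq → S, ∀ f : S, D (𝒯 f) = f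

/-- `T`-density: all the outputs are `T`-dense. -/
def IsDense (𝒯 : TEM S) (T : ℝ) : Prop := ∀ f : S, (𝒯 f).IsDense T

/-- Integrate-and-fire machines with test functions `Φ`: `tₙ` is the first time after `tₙ₋₁` at
which the integral of the signal from `tₙ₋₁` meets `Φₙ`. -/
def IsIntegrateAndFire (𝒯 : TEM S) (Φ : TestRule) : Prop :=
  ∀ (f : S) (n : ℤ),
    (∫ u in (𝒯 f).t (n - 1)..(𝒯 f).t n, (f : ℝ → ℝ) u)
        = Φ n ((𝒯 f).past n) ((𝒯 f).t n) ∧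
      ∀ r ∈ Set.Ioo ((𝒯 f).t (n - 1)) ((𝒯 f).t n),
        (∫ u in (𝒯 f).t (n - 1)..r, (f : ℝ → ℝ) u) ≠ Φ n ((𝒯 f).past n) r

end TEM

end

/-! Everything rests on one estimate: on V²(λ) the operator Id − PZ has norm at most T/τ. Two
inequalities multiply to give this constant.

Bernstein: τ‖f'‖ ≤ π‖f‖ on V²(λ) (`IsGenerator.exists_deriv`). The Fourier transform of ∑ cₖ h(· −
k) is a periodic trigonometric sum times ĥ, so by Plancherel and periodization its squared norm is
the integral of |trigonometric sum|² G_h² over one period (`enorm_sum_translateL2`). The pointwise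
bound τ G_{λ'} ≤ π G_λ thus passes to norms. The bounds A ≤ G_λ ≤ B make the translates of λ a Riesz
sequence, whence V²(λ) is complete; together with a local Sobolev bound, Bernstein makes point
evaluations bounded, whence the kernel.

Wirtinger: on an interval of length at most T, the L² norm of f − f(midpoint) is at most T/π times
that of f' (`integral_sq_sub_midpoint_le`), proved on each half by a Schur test with a cosine
weight.

For F in V²(λ) put E = F − PZF. Since PE = E and K reproduces values, ‖E‖² = ∑ ∫ F (E − E(sₙ₊₁))
over the intervals [tₙ, tₙ₊₁]. Cauchy–Schwarz, Wirtinger and Bernstein bound this by (T/τ)‖F‖‖E‖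
(`IsGenerator.norm_sub_starProjection_Z_le`). As T/τ < 1, the iteration converges geometrically, and
Zf determines f. The firing equations express Zf through the output alone, so the encoding is
injective, hence invertible. -/

noncomputable section

/-! ### Translations under the L² Fourier transform -/

/-- Translation by `a` on `L²(ℝ)`. -/
def translateL2 (E : Type*) [NormedAddCommGroup E] [NormedSpace ℝ E] (a : ℝ) :
    Lp E 2 (volume : Measure ℝ) →ₗᵢ[ℝ] Lp E 2 (volume : Measure ℝ) :=
  Lp.compMeasurePreservingₗᵢ ℝ (fun x : ℝ => x - a) (measurePreserving_sub_right volume a)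

theorem coeFn_translateL2 {E : Type*} [NormedAddCommGroup E] [NormedSpace ℝ E] (a : ℝ)
    (f : Lp E 2 (volume : Measure ℝ)) :
    translateL2 E a f =ᵐ[volume] fun x => f (x - a) :=
  Lp.coeFn_compMeasurePreserving f (measurePreserving_sub_right volume a)

theorem memLp_fourierChar_mul (a : ℝ) :
    MemLp (fun ξ : ℝ => (Real.fourierChar (-(a * ξ)) : ℂ)) ⊤ (volume : Measure ℝ) := by
  refine memLp_top_of_bound (C := 1) ?_ ?_
  · refine Continuous.aestronglyMeasurable ?_
    exact continuous_subtype_val.comp (Real.continuous_fourierChar.comp (by fun_prop))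
  · exact Eventually.of_forall fun ξ => (Circle.norm_coe _).le

/-- The `L²` Fourier transform of a translate. -/
theorem fourier_translateL2 (a : ℝ) (H : Lp ℂ 2 (volume : Measure ℝ)) :
    (𝓕 (translateL2 ℂ a H) : Lp ℂ 2 (volume : Measure ℝ)) =ᵐ[volume]
      fun ξ => (Real.fourierChar (-(a * ξ)) : ℂ) * (𝓕 H : Lp ℂ 2 (volume : Measure ℝ)) ξ := by
  -- Multiplication by the character is made a bounded operator `B` on L². Both sides are then
  -- continuous in `H`, and it suffices to check Schwartz functions.
  set M : Lp ℂ ⊤ (volume : Measure ℝ) := (memLp_fourierChar_mul a).toLp with hM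
  set B := (ContinuousLinearMap.mul ℂ ℂ).holderL (volume : Measure ℝ) ⊤ 2 2 M with hB
  have hBc : ∀ g : Lp ℂ 2 (volume : Measure ℝ), B g =ᵐ[volume]
      fun ξ => (Real.fourierChar (-(a * ξ)) : ℂ) * g ξ := by
    intro g
    have h1 := (ContinuousLinearMap.mul ℂ ℂ).coeFn_holder (r := 2) M g
    filter_upwards [h1, (memLp_fourierChar_mul a).coeFn_toLp] with ξ h1 h2
    rw [hB, ContinuousLinearMap.holderL_apply_apply, h1, hM, h2]
    simp
  suffices h : 𝓕 (translateL2 ℂ a H) = B (𝓕 H) by rw [h]; exact hBc _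
  refine DenseRange.induction_on (p := fun H => 𝓕 (translateL2 ℂ a H) = B (𝓕 H))
    (SchwartzMap.denseRange_toLpCLM (F := ℂ) (E := ℝ) (p := 2)
      (μ := (volume : Measure ℝ)) ENNReal.ofNat_ne_top) H ?_ ?_
  · refine isClosed_eq ?_ ?_
    · exact (Lp.fourierTransformₗᵢ ℝ ℂ).continuous.comp (translateL2 ℂ a).continuous
    · exact B.continuous.comp (Lp.fourierTransformₗᵢ ℝ ℂ).continuous
  · intro φ
    have e1 : translateL2 ℂ a (φ.toLp 2) = (φ.compSubConstCLM ℂ a).toLp 2 := by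
      apply Lp.ext
      have h0 := (measurePreserving_sub_right (volume : Measure ℝ) a).quasiMeasurePreserving.ae
        (φ.coeFn_toLp 2 (volume : Measure ℝ))
      filter_upwards [coeFn_translateL2 a (φ.toLp 2),
        (φ.compSubConstCLM ℂ a).coeFn_toLp 2 (volume : Measure ℝ), h0] with x h1 h2 h3
      rw [h1, h2, h3]; rfl
    change 𝓕 (translateL2 ℂ a (φ.toLp 2)) = B (𝓕 (φ.toLp 2))
    rw [e1, SchwartzMap.toLp_fourier_eq, SchwartzMap.toLp_fourier_eq]
    apply Lp.ext
    filter_upwards [hBc ((𝓕 φ).toLp 2), (𝓕 φ).coeFn_toLp 2 (volume : Measure ℝ),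
      (𝓕 (φ.compSubConstCLM ℂ a)).coeFn_toLp 2 (volume : Measure ℝ)] with ξ h1 h2 h3
    rw [h1, h2, h3, SchwartzMap.fourier_coe, SchwartzMap.fourier_coe]
    have := congrFun (VectorFourier.fourierIntegral_comp_add_right Real.fourierChar volume
      (innerₗ ℝ) (φ : ℝ → ℂ) (-a)) ξ
    have h4 : ((φ.compSubConstCLM ℂ a : SchwartzMap ℝ ℂ) : ℝ → ℂ)
        = (φ : ℝ → ℂ) ∘ fun v => v + -a := by
      funext x; simp [SchwartzMap.compSubConstCLM_apply, sub_eq_add_neg]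
    rw [h4]
    change VectorFourier.fourierIntegral Real.fourierChar volume (innerₗ ℝ)
      ((φ : ℝ → ℂ) ∘ fun v => v + -a) ξ = _
    rw [this]
    simp [Circle.smul_def, mul_comm]
    rfl

/-! ### Trigonometric polynomials, periodization and Gram symbols -/

/-- The trigonometric polynomial `∑ cₖ exp(-2πikξ)`. -/
def trigPoly (s : Finset ℤ) (c : ℤ → ℝ) (ξ : ℝ) : ℂ :=
  ∑ k ∈ s, (c k : ℂ) * (Real.fourierChar (-(k * ξ)) : ℂ)

theorem continuous_trigPoly (s : Finset ℤ) (c : ℤ → ℝ) : Continuous (trigPoly s c) := by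
  unfold trigPoly
  refine continuous_finsetSum _ fun k _ => continuous_const.mul ?_
  exact continuous_subtype_val.comp (Real.continuous_fourierChar.comp (by fun_prop))

theorem trigPoly_add_int (s : Finset ℤ) (c : ℤ → ℝ) (ξ : ℝ) (n : ℤ) :
    trigPoly s c (ξ + n) = trigPoly s c ξ := by
  unfold trigPoly
  refine Finset.sum_congr rfl fun k _ => ?_
  congr 1
  rw [Real.fourierChar_apply, Real.fourierChar_apply, Complex.exp_eq_exp_iff_exists_int]
  exact ⟨-(k * n), by push_cast; ring⟩

theorem enorm_sq_eq_lintegral {E : Type*} [NormedAddCommGroup E] {α : Type*} [MeasurableSpace α]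
    {μ : Measure α} (f : Lp E 2 μ) : ‖f‖ₑ ^ 2 = ∫⁻ x, ‖f x‖ₑ ^ 2 ∂μ := by
  rw [Lp.enorm_def]
  rw [eLpNorm_eq_lintegral_rpow_enorm_toReal (by simp) (by simp)]
  simp only [ENNReal.toReal_ofNat, ENNReal.rpow_ofNat]
  rw [← ENNReal.rpow_natCast, ← ENNReal.rpow_mul]
  norm_num

/-- Parseval on the circle of length 1, where the exponentials are orthonormal. -/
theorem lintegral_trigPoly (s : Finset ℤ) (c : ℤ → ℝ) :
    ∫⁻ ξ in Set.Ioc (0 : ℝ) 1, ‖trigPoly s c ξ‖ₑ ^ 2 = ENNReal.ofReal (∑ k ∈ s, c k ^ 2) := by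
  set p : AddCircle (1 : ℝ) → ℂ := fun x => ∑ k ∈ s, (c k : ℂ) * fourier (-k) x with hp
  have hpt : ∀ ξ : ℝ, trigPoly s c ξ = p (ξ : AddCircle (1 : ℝ)) := by
    intro ξ
    simp only [hp, trigPoly]
    refine Finset.sum_congr rfl fun k _ => ?_
    congr 1
    rw [Real.fourierChar_apply, fourier_coe_apply]
    congr 1; push_cast; ring
  have hpc : Continuous p := by
    refine continuous_finsetSum _ fun k _ => continuous_const.mul (fourier (-k)).continuous
  simp_rw [hpt]
  have h1 := AddCircle.lintegral_preimage (1 : ℝ) 0 (fun x => ‖p x‖ₑ ^ 2)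
  rw [zero_add] at h1
  rw [h1]
  set q : Lp ℂ 2 (AddCircle.haarAddCircle (T := 1)) :=
    ∑ k ∈ s, (c k : ℂ) • fourierLp 2 (-k) with hq
  have hqp : q =ᵐ[AddCircle.haarAddCircle] p := by
    have h2 : ∀ᵐ x ∂(AddCircle.haarAddCircle (T := 1)), ∀ k ∈ s,
        ((c k : ℂ) • fourierLp (T := 1) 2 (-k) : Lp ℂ 2 (AddCircle.haarAddCircle (T := 1))) x
          = (c k : ℂ) * fourier (-k) x := by
      rw [Finset.eventually_all]
      intro k _
      filter_upwards [Lp.coeFn_smul (c k : ℂ) (fourierLp (T := 1) 2 (-k)),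
        coeFn_fourierLp (T := 1) 2 (-k)] with x h3 h4
      rw [h3, Pi.smul_apply, h4, smul_eq_mul]
    filter_upwards [h2, Lp.coeFn_finsetSum s
      (fun k => ((c k : ℂ) • fourierLp (T := 1) 2 (-k)))] with x h3 h4
    rw [hq, h4, Finset.sum_apply]
    exact Finset.sum_congr rfl h3
  have hn : ‖q‖ₑ ^ 2 = ∫⁻ x, ‖p x‖ₑ ^ 2 ∂(AddCircle.haarAddCircle (T := 1)) := by
    rw [enorm_sq_eq_lintegral]
    exact lintegral_congr_ae (hqp.mono fun x hx => by simp only [hx])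
  have hv : (volume : Measure (AddCircle (1 : ℝ))) = AddCircle.haarAddCircle := by
    rw [AddCircle.volume_eq_smul_haarAddCircle]; simp
  rw [hv, ← hn]
  have ho : ‖q‖ ^ 2 = ∑ k ∈ s, c k ^ 2 := by
    have h5 : Orthonormal ℂ (fun k : ℤ => fourierLp (T := 1) 2 (-k)) :=
      orthonormal_fourier.comp _ neg_injective
    have := h5.inner_sum (fun k => (c k : ℂ)) (fun k => (c k : ℂ)) s
    rw [← hq, inner_self_eq_norm_sq_to_K] at this
    have h6 : ((‖q‖ ^ 2 : ℝ) : ℂ) = ((∑ k ∈ s, c k ^ 2 : ℝ) : ℂ) := by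
      push_cast
      rw [← Complex.coe_algebraMap]
      simpa [sq] using this
    exact_mod_cast h6
  rw [← ho, ENNReal.ofReal_pow (norm_nonneg _), ofReal_norm]

/-- The line is cut into the intervals ]k, k + 1], each shifted back to ]0, 1]. -/
theorem lintegral_eq_lintegral_tsum_int (g : ℝ → ℝ≥0∞) (hg : AEMeasurable g) :
    ∫⁻ ξ, g ξ = ∫⁻ ξ in Set.Ioc (0 : ℝ) 1, ∑' k : ℤ, g (ξ + k) := by
  rw [lintegral_tsum]
  · rw [← setLIntegral_univ, ← iUnion_Ioc_intCast ℝ,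
      lintegral_iUnion (fun _ => measurableSet_Ioc) (Set.pairwise_disjoint_Ioc_intCast ℝ)]
    refine tsum_congr fun k => ?_
    have h := (measurePreserving_add_right (volume : Measure ℝ) (k : ℝ)).setLIntegral_comp_preimage_emb
      (measurableEmbedding_addRight (k : ℝ)) g (Set.Ioc (k : ℝ) (k + 1))
    rw [← h]
    congr 2
    ext x; simp
  · intro k
    exact ((measurePreserving_add_right (volume : Measure ℝ) (k : ℝ)).aemeasurable_comp_iff
      (measurableEmbedding_addRight (k : ℝ))).2 hg |>.restrict

/-- Plancherel turns the combination into `trigPoly` times `𝓕 H`; the periodic factor then comes out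
of the sum over integer shifts. -/
theorem enorm_sum_translateL2_complex (H : Lp ℂ 2 (volume : Measure ℝ)) (s : Finset ℤ) (c : ℤ → ℝ) :
    ‖∑ k ∈ s, c k • translateL2 ℂ k H‖ₑ ^ 2 =
      ∫⁻ ξ in Set.Ioc (0 : ℝ) 1, ‖trigPoly s c ξ‖ₑ ^ 2 *
        ∑' k : ℤ, ‖(𝓕 H : Lp ℂ 2 (volume : Measure ℝ)) (ξ + k)‖ₑ ^ 2 := by
  set F := ∑ k ∈ s, c k • translateL2 ℂ k H with hF
  have h1 : (𝓕 F : Lp ℂ 2 (volume : Measure ℝ)) =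
      ∑ k ∈ s, (c k : ℂ) • (𝓕 (translateL2 ℂ k H) : Lp ℂ 2 (volume : Measure ℝ)) := by
    change Lp.fourierTransformₗᵢ ℝ ℂ F = ∑ k ∈ s, (c k : ℂ) • Lp.fourierTransformₗᵢ ℝ ℂ _
    rw [hF, map_sum]
    refine Finset.sum_congr rfl fun k _ => ?_
    rw [← map_smul (Lp.fourierTransformₗᵢ ℝ ℂ)]
    congr 1
  have h2 : (𝓕 F : Lp ℂ 2 (volume : Measure ℝ)) =ᵐ[volume]
      fun ξ => trigPoly s c ξ * (𝓕 H : Lp ℂ 2 (volume : Measure ℝ)) ξ := by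
    have h3 : ∀ᵐ ξ : ℝ, ∀ k ∈ s,
        ((c k : ℂ) • (𝓕 (translateL2 ℂ k H)) : Lp ℂ 2 (volume : Measure ℝ)) ξ =
          (c k : ℂ) * (Real.fourierChar (-(k * ξ)) : ℂ) *
            (𝓕 H : Lp ℂ 2 (volume : Measure ℝ)) ξ := by
      rw [Finset.eventually_all]
      intro k _
      filter_upwards [Lp.coeFn_smul (c k : ℂ) (𝓕 (translateL2 ℂ k H) : Lp ℂ 2 (volume : Measure ℝ)),
        fourier_translateL2 k H] with x h3 h4
      rw [h3, Pi.smul_apply, h4, smul_eq_mul, mul_assoc]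
    filter_upwards [h3, Lp.coeFn_finsetSum s
      (fun k => (c k : ℂ) • (𝓕 (translateL2 ℂ k H) : Lp ℂ 2 (volume : Measure ℝ)))] with x h3 h4
    rw [h1, h4, Finset.sum_apply, trigPoly, Finset.sum_mul]
    exact Finset.sum_congr rfl h3
  have h5 : ‖F‖ₑ = ‖(𝓕 F : Lp ℂ 2 (volume : Measure ℝ))‖ₑ := by
    rw [← ofReal_norm, ← ofReal_norm, Lp.norm_fourier_eq]
  rw [h5, enorm_sq_eq_lintegral]
  rw [lintegral_congr_ae (g := fun ξ => ‖trigPoly s c ξ‖ₑ ^ 2 *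
    ‖(𝓕 H : Lp ℂ 2 (volume : Measure ℝ)) ξ‖ₑ ^ 2)
    (h2.mono fun ξ h => by simp only [h, enorm_mul, mul_pow])]
  rw [lintegral_eq_lintegral_tsum_int]
  · refine lintegral_congr fun ξ => ?_
    simp_rw [trigPoly_add_int, ENNReal.tsum_mul_left]
  · exact ((continuous_trigPoly s c).aestronglyMeasurable.enorm.pow_const 2).mul
      ((Lp.aestronglyMeasurable _).enorm.pow_const 2)

theorem gramSymbol_two_pi_sq (h : ℝ → ℝ) (hh : MemLp h 2 (volume : Measure ℝ)) (ξ : ℝ) :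
    gramSymbol h hh (2 * Real.pi * ξ) ^ 2 = ∑' k : ℤ,
      ‖(𝓕 (hh.ofReal (K := ℂ)).toLp : Lp ℂ 2 (volume : Measure ℝ)) (ξ + k)‖ₑ ^ 2 := by
  unfold gramSymbol fourierL2
  rw [← ENNReal.rpow_natCast, ← ENNReal.rpow_mul]
  norm_num
  refine tsum_congr fun k => ?_
  congr 4
  field_simp

/-- `‖∑ cₖ h(· - k)‖² = ∫₀¹ |∑ cₖ exp(-2πikξ)|² G_h(2πξ)² dξ`. -/
theorem enorm_sum_translateL2 (h : ℝ → ℝ) (hh : MemLp h 2 (volume : Measure ℝ))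
    (s : Finset ℤ) (c : ℤ → ℝ) :
    ‖∑ k ∈ s, c k • translateL2 ℝ k (hh.toLp h)‖ₑ ^ 2 =
      ∫⁻ ξ in Set.Ioc (0 : ℝ) 1, ‖trigPoly s c ξ‖ₑ ^ 2 *
        gramSymbol h hh (2 * Real.pi * ξ) ^ 2 := by
  simp_rw [gramSymbol_two_pi_sq]
  rw [← enorm_sum_translateL2_complex]
  -- The inclusion of real into complex L² is isometric and commutes with translations, which
  -- transfers the complex identity.
  set C := Complex.ofRealCLM.compLpL 2 (volume : Measure ℝ) with hC
  have hCc : ∀ f : Lp ℝ 2 (volume : Measure ℝ), C f =ᵐ[volume] fun x => (f x : ℂ) := fun f =>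
    Complex.ofRealCLM.coeFn_compLpL f
  have hCn : ∀ f, ‖C f‖ₑ = ‖f‖ₑ := by
    intro f
    rw [Lp.enorm_def, Lp.enorm_def, eLpNorm_congr_ae (hCc f)]
    refine eLpNorm_congr_norm_ae (Eventually.of_forall fun x => by simp)
  have e1 : C (hh.toLp h) = (hh.ofReal (K := ℂ)).toLp := by
    apply Lp.ext
    filter_upwards [hCc (hh.toLp h), hh.coeFn_toLp, (hh.ofReal (K := ℂ)).coeFn_toLp] with x h1 h2 h3
    rw [h1, h2, h3]; rfl
  have e2 : ∀ (a : ℝ) (f : Lp ℝ 2 (volume : Measure ℝ)),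
      C (translateL2 ℝ a f) = translateL2 ℂ a (C f) := by
    intro a f
    apply Lp.ext
    have h0 := (measurePreserving_sub_right (volume : Measure ℝ) a).quasiMeasurePreserving.ae (hCc f)
    filter_upwards [hCc (translateL2 ℝ a f), coeFn_translateL2 a f, coeFn_translateL2 a (C f), h0]
      with x h1 h2 h3 h4
    rw [h1, h2, h3, h4]
  rw [← hCn, map_sum]
  simp_rw [map_smul, e2, e1]

theorem ae_comp_two_pi_mul {p : ℝ → Prop} (h : ∀ᵐ ω : ℝ, p ω) : ∀ᵐ ξ : ℝ, p (2 * Real.pi * ξ) := by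
  have hpi : (2 * Real.pi) ≠ 0 := by positivity
  have hq : Measure.QuasiMeasurePreserving (fun ξ : ℝ => 2 * Real.pi * ξ) volume volume := by
    refine ⟨by fun_prop, ?_⟩
    rw [Real.map_volume_mul_left hpi]
    exact Measure.smul_absolutelyContinuous
  exact hq.ae h

/-- Both norms integrate the same |trigonometric polynomial|² against a squared symbol, so a
pointwise comparison of symbols passes to norms with the same constants. With a = τ and b = π this
is Bernstein's inequality for finite sums. -/
theorem mul_enorm_sum_le_of_gramSymbol_le {h g : ℝ → ℝ} (hh : MemLp h 2 (volume : Measure ℝ))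
    (hg : MemLp g 2 (volume : Measure ℝ)) {a b : ℝ≥0∞} (ha : a ≠ ⊤) (hb : b ≠ ⊤)
    (hab : ∀ᵐ ω : ℝ, a * gramSymbol h hh ω ≤ b * gramSymbol g hg ω) (s : Finset ℤ) (c : ℤ → ℝ) :
    a * ‖∑ k ∈ s, c k • translateL2 ℝ k (hh.toLp h)‖ₑ ≤
      b * ‖∑ k ∈ s, c k • translateL2 ℝ k (hg.toLp g)‖ₑ := by
  rw [← ENNReal.pow_le_pow_left_iff two_ne_zero, mul_pow, mul_pow, enorm_sum_translateL2,
    enorm_sum_translateL2, ← lintegral_const_mul' _ _ (by finiteness),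
    ← lintegral_const_mul' _ _ (by finiteness)]
  refine lintegral_mono_ae (ae_restrict_of_ae ?_)
  filter_upwards [ae_comp_two_pi_mul hab] with ξ h1
  calc _ = ‖trigPoly s c ξ‖ₑ ^ 2 * (a * gramSymbol h hh (2 * Real.pi * ξ)) ^ 2 := by ring
    _ ≤ ‖trigPoly s c ξ‖ₑ ^ 2 * (b * gramSymbol g hg (2 * Real.pi * ξ)) ^ 2 := by gcongr
    _ = _ := by ring

theorem enorm_sum_sq_le_of_gramSymbol_le {h : ℝ → ℝ} (hh : MemLp h 2 (volume : Measure ℝ))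
    {B : ℝ≥0∞} (hB : B ≠ ⊤) (hab : ∀ᵐ ω : ℝ, gramSymbol h hh ω ≤ B) (s : Finset ℤ) (c : ℤ → ℝ) :
    ‖∑ k ∈ s, c k • translateL2 ℝ k (hh.toLp h)‖ₑ ^ 2 ≤
      B ^ 2 * ENNReal.ofReal (∑ k ∈ s, c k ^ 2) := by
  rw [enorm_sum_translateL2, ← lintegral_trigPoly, ← lintegral_const_mul' _ _ (by finiteness)]
  refine lintegral_mono_ae (ae_restrict_of_ae ?_)
  filter_upwards [ae_comp_two_pi_mul hab] with ξ h1
  rw [mul_comm]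
  gcongr

theorem le_enorm_sum_sq_of_le_gramSymbol {h : ℝ → ℝ} (hh : MemLp h 2 (volume : Measure ℝ))
    {A : ℝ≥0∞} (hA : A ≠ ⊤) (hab : ∀ᵐ ω : ℝ, A ≤ gramSymbol h hh ω) (s : Finset ℤ) (c : ℤ → ℝ) :
    A ^ 2 * ENNReal.ofReal (∑ k ∈ s, c k ^ 2) ≤
      ‖∑ k ∈ s, c k • translateL2 ℝ k (hh.toLp h)‖ₑ ^ 2 := by
  rw [enorm_sum_translateL2, ← lintegral_trigPoly, ← lintegral_const_mul' _ _ (by finiteness)]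
  refine lintegral_mono_ae (ae_restrict_of_ae ?_)
  filter_upwards [ae_comp_two_pi_mul hab] with ξ h1
  rw [mul_comm]
  gcongr

/-! ### Riesz bounds and the constant τ -/

namespace SobolevH1

/-- The translate `λ(· - k)` as an element of `L²(ℝ)`. -/
def gen (lam : SobolevH1) (k : ℤ) : Lp ℝ 2 (volume : Measure ℝ) :=
  translateL2 ℝ k (lam.memLp_toFun.toLp lam.toFun)

/-- The translate `λ'(· - k)` as an element of `L²(ℝ)`. -/
def genDeriv (lam : SobolevH1) (k : ℤ) : Lp ℝ 2 (volume : Measure ℝ) :=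
  translateL2 ℝ k (lam.memLp_deriv.toLp lam.deriv)

variable {lam : SobolevH1}

theorem IsGenerator.exists_riesz_bounds (hlam : lam.IsGenerator) :
    ∃ A B : ℝ, 0 < A ∧ 0 < B ∧ ∀ (s : Finset ℤ) (c : ℤ → ℝ),
      A ^ 2 * ∑ k ∈ s, c k ^ 2 ≤ ‖∑ k ∈ s, c k • lam.gen k‖ ^ 2 ∧
      ‖∑ k ∈ s, c k • lam.gen k‖ ^ 2 ≤ B ^ 2 * ∑ k ∈ s, c k ^ 2 := by
  obtain ⟨A, B, hA, hB, hAB⟩ := hlam.bounds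
  obtain ⟨ω, hω⟩ := hAB.exists
  have hAB' : A ≤ B := hω.1.trans hω.2
  have hAt : A ≠ ⊤ := (hAB'.trans_lt hB).ne
  have hB0 : 0 < B := hA.trans_le hAB'
  refine ⟨A.toReal, B.toReal, ENNReal.toReal_pos hA.ne' hAt, ENNReal.toReal_pos hB0.ne' hB.ne,
    fun s c => ?_⟩
  have hs : 0 ≤ ∑ k ∈ s, c k ^ 2 := Finset.sum_nonneg fun _ _ => sq_nonneg _
  have h1 := le_enorm_sum_sq_of_le_gramSymbol lam.memLp_toFun hAt (hAB.mono fun _ h => h.1) s c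
  have h2 := enorm_sum_sq_le_of_gramSymbol_le lam.memLp_toFun hB.ne (hAB.mono fun _ h => h.2) s c
  constructor
  · have := ENNReal.toReal_mono (by finiteness) h1
    rwa [ENNReal.toReal_mul, ENNReal.toReal_pow, ENNReal.toReal_pow, ENNReal.toReal_ofReal hs,
      toReal_enorm] at this
  · have := ENNReal.toReal_mono (by finiteness) h2
    rwa [ENNReal.toReal_mul, ENNReal.toReal_pow, ENNReal.toReal_pow, ENNReal.toReal_ofReal hs,
      toReal_enorm] at this

/-- The finite essential supremum of G_{λ'}/G_λ bounds G_λ/G_{λ'} below by its inverse; inverting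
the quotient is legitimate because G_λ is almost everywhere neither 0 nor ∞. -/
theorem IsGenerator.tau_pos (hlam : lam.IsGenerator) : 0 < lam.tau := by
  obtain ⟨A, B, hA, hB, hAB⟩ := hlam.bounds
  have hpi : 0 < ENNReal.ofReal Real.pi := ENNReal.ofReal_pos.2 Real.pi_pos
  refine ENNReal.mul_pos hpi.ne' (ne_of_gt ?_)
  refine lt_of_lt_of_le (ENNReal.inv_pos.2 hlam.sup_lt_top.ne) (le_essInf_of_ae_le _ ?_)
  filter_upwards [hAB, ENNReal.ae_le_essSup (μ := volume) fun ω : ℝ => lam.G' ω / lam.G ω]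
    with ω h1 h2
  have h0 : lam.G ω ≠ 0 := (hA.trans_le h1.1).ne'
  have ht : lam.G ω ≠ ⊤ := (h1.2.trans_lt hB).ne
  rw [← ENNReal.inv_div (Or.inl ht) (Or.inl h0)]
  exact ENNReal.inv_le_inv.2 h2

theorem tau_mul_G'_le (lam : SobolevH1) :
    ∀ᵐ ω : ℝ, lam.tau * lam.G' ω ≤ ENNReal.ofReal Real.pi * lam.G ω := by
  filter_upwards [ae_essInf_le (μ := volume) (f := fun ω : ℝ => lam.G ω / lam.G' ω)] with ω h
  rw [tau, mul_assoc]
  gcongr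
  exact ENNReal.mul_le_of_le_div h

/-- With τ = ∞, the bound τ G_{λ'} ≤ π G_λ < ∞ forces G_{λ'} = 0 almost everywhere; the one-term
combination then gives ‖λ'‖ = 0. -/
theorem IsGenerator.deriv_toLp_eq_zero_of_tau_eq_top (hlam : lam.IsGenerator) (h : lam.tau = ⊤) :
    lam.memLp_deriv.toLp lam.deriv = 0 := by
  obtain ⟨A, B, hA, hB, hAB⟩ := hlam.bounds
  have hG : ∀ᵐ ω : ℝ, gramSymbol lam.deriv lam.memLp_deriv ω ≤ 0 := by
    filter_upwards [hAB, lam.tau_mul_G'_le] with ω h1 h2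
    rw [h] at h2
    by_contra h3
    have h4 : lam.G' ω ≠ 0 := fun h => h3 h.le
    rw [ENNReal.top_mul h4] at h2
    have h5 : ENNReal.ofReal Real.pi * lam.G ω < ⊤ :=
      ENNReal.mul_lt_top (by finiteness) (h1.2.trans_lt hB)
    exact absurd h2 (not_le.2 h5)
  have := enorm_sum_sq_le_of_gramSymbol_le lam.memLp_deriv (by simp) hG {0} 1
  generalize lam.memLp_deriv.toLp lam.deriv = X at this ⊢
  simpa using this

theorem tau_mul_norm_genDeriv_le (h : lam.tau ≠ ⊤) (s : Finset ℤ) (c : ℤ → ℝ) :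
    lam.tau.toReal * ‖∑ k ∈ s, c k • lam.genDeriv k‖ ≤ Real.pi * ‖∑ k ∈ s, c k • lam.gen k‖ := by
  have h1 := mul_enorm_sum_le_of_gramSymbol_le lam.memLp_deriv lam.memLp_toFun h
    ENNReal.ofReal_ne_top lam.tau_mul_G'_le s c
  have := ENNReal.toReal_mono (by finiteness) h1
  rwa [ENNReal.toReal_mul, ENNReal.toReal_mul, ENNReal.toReal_ofReal Real.pi_pos.le,
    toReal_enorm, toReal_enorm] at this

end SobolevH1

/-! ### The continuous representative as a primitive of the weak derivative -/

/-- A smooth approximation of the indicator of `[a, b]`. -/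
def smoothIndicator (ρ : ContDiffBump (0 : ℝ)) (a b x : ℝ) : ℝ :=
  ∫ y in (x - b)..(x - a), ρ.normed volume y

namespace smoothIndicator

variable (ρ : ContDiffBump (0 : ℝ)) (a b : ℝ)

theorem intervalIntegrable_normed (c d : ℝ) : IntervalIntegrable (ρ.normed volume) volume c d :=
  (ρ.continuous_normed).intervalIntegrable _ _

theorem eq_sub : smoothIndicator ρ a b = fun x =>
    (∫ y in (0 : ℝ)..(x - a), ρ.normed volume y) - ∫ y in (0 : ℝ)..(x - b), ρ.normed volume y := by
  funext x
  rw [intervalIntegral.integral_interval_sub_left (intervalIntegrable_normed ρ _ _)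
    (intervalIntegrable_normed ρ _ _)]
  rfl

theorem hasDerivAt_primitive (x : ℝ) : HasDerivAt (fun x => ∫ y in (0 : ℝ)..x, ρ.normed volume y)
    (ρ.normed volume x) x :=
  (ρ.continuous_normed).integral_hasStrictDerivAt 0 x |>.hasDerivAt

theorem contDiff_primitive : ContDiff ℝ (⊤ : ℕ∞) (fun x => ∫ y in (0 : ℝ)..x, ρ.normed volume y) := by
  rw [contDiff_infty_iff_deriv]
  refine ⟨fun x => (hasDerivAt_primitive ρ x).differentiableAt, ?_⟩
  rw [show deriv (fun x => ∫ y in (0 : ℝ)..x, ρ.normed volume y) = ρ.normed volume from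
    funext fun x => (hasDerivAt_primitive ρ x).deriv]
  exact ρ.contDiff_normed

theorem contDiff : ContDiff ℝ (⊤ : ℕ∞) (smoothIndicator ρ a b) := by
  rw [eq_sub]
  exact ((contDiff_primitive ρ).comp (contDiff_id.sub contDiff_const)).sub
    ((contDiff_primitive ρ).comp (contDiff_id.sub contDiff_const))

theorem deriv_eq (x : ℝ) : deriv (smoothIndicator ρ a b) x =
    ρ.normed volume (x - a) - ρ.normed volume (x - b) := by
  rw [eq_sub]
  exact (((hasDerivAt_primitive ρ (x - a)).comp_sub_const x a).sub
    ((hasDerivAt_primitive ρ (x - b)).comp_sub_const x b)).deriv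

variable {ρ a b}

theorem normed_eq_zero {y : ℝ} (hy : ρ.rOut ≤ |y|) : ρ.normed volume y = 0 := by
  have : y ∉ Function.support (ρ.normed (volume : Measure ℝ)) := by
    rw [ρ.support_normed_eq]; simpa using hy
  simpa using this

theorem eq_zero_of_le {x : ℝ} (hab : a ≤ b) (hx : x ≤ a - ρ.rOut ∨ b + ρ.rOut ≤ x) :
    smoothIndicator ρ a b x = 0 := by
  have : ∀ y ∈ Set.uIcc (x - b) (x - a), ρ.normed volume y = (0 : ℝ) := by
    intro y hy
    rw [Set.uIcc_of_le (by linarith)] at hy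
    apply normed_eq_zero
    rcases hx with hx | hx
    · exact le_trans (by linarith [hy.2]) (neg_le_abs y)
    · exact le_trans (by linarith [hy.1]) (le_abs_self y)
  rw [smoothIndicator, intervalIntegral.integral_congr this]
  simp

theorem eq_one {x : ℝ} (hx : a + ρ.rOut ≤ x) (hx' : x ≤ b - ρ.rOut) :
    smoothIndicator ρ a b x = 1 := by
  have h0 := ρ.rOut_pos
  rw [smoothIndicator, intervalIntegral.integral_of_le (by linarith),
    setIntegral_eq_integral_of_forall_compl_eq_zero, ρ.integral_normed]
  intro y hy
  apply normed_eq_zero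
  by_contra h
  rw [not_le, abs_lt] at h
  exact hy ⟨by linarith, by linarith⟩

theorem nonneg (hab : a ≤ b) (x : ℝ) : 0 ≤ smoothIndicator ρ a b x :=
  intervalIntegral.integral_nonneg (by linarith) fun _ _ => ρ.nonneg_normed _

theorem le_one (hab : a ≤ b) (x : ℝ) : smoothIndicator ρ a b x ≤ 1 := by
  rw [smoothIndicator, intervalIntegral.integral_of_le (by linarith),
    ← ρ.integral_normed (μ := volume)]
  exact setIntegral_le_integral ρ.integrable_normed (Eventually.of_forall ρ.nonneg_normed)

theorem hasCompactSupport (hab : a ≤ b) : HasCompactSupport (smoothIndicator ρ a b) := by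
  refine HasCompactSupport.intro (isCompact_Icc (a := a - ρ.rOut) (b := b + ρ.rOut)) fun x hx => ?_
  apply eq_zero_of_le hab
  by_contra h
  rw [not_or, not_le, not_le] at h
  exact hx ⟨h.1.le, h.2.le⟩

end smoothIndicator

/-- The integral is a convolution with an approximate identity, the bump being even. -/
theorem tendsto_integral_normed_mul {ρ : ℕ → ContDiffBump (0 : ℝ)}
    (hρ : Tendsto (fun n => (ρ n).rOut) atTop (𝓝 0)) {f : ℝ → ℝ} (hf : Continuous f) (a : ℝ) :
    Tendsto (fun n => ∫ x, f x * (ρ n).normed volume (x - a)) atTop (𝓝 (f a)) := by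
  have h := ContDiffBump.convolution_tendsto_right_of_continuous (μ := volume) hρ hf a
  refine h.congr fun n => ?_
  rw [MeasureTheory.convolution_eq_swap]
  refine integral_congr_ae (Eventually.of_forall fun x => ?_)
  simp only [ContinuousLinearMap.lsmul_apply, smul_eq_mul]
  rw [mul_comm, ← (ρ n).normed_neg (x - a), neg_sub]

theorem MemLp.intervalIntegrable_of_two {v : ℝ → ℝ} (hv : MemLp v 2 (volume : Measure ℝ)) (a b : ℝ) :
    IntervalIntegrable v volume a b := by
  have := (hv.locallyIntegrable (by norm_num)).integrableOn_isCompact (isCompact_uIcc (a := a) (b := b))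
  exact this.intervalIntegrable

/-- The continuous representative is a primitive of the weak derivative. -/
theorem SobolevH1.sub_eq_integral (lam : SobolevH1) (a b : ℝ) :
    lam.toFun b - lam.toFun a = ∫ x in a..b, lam.deriv x := by
  wlog hab : a ≤ b generalizing a b
  · rw [intervalIntegral.integral_symm, ← this b a (by linarith)]; ring
  -- The outer radii tend to 0 and never exceed 1, so all the smooth indicators vanish outside [a −
  -- 1, b + 1], the domain of the dominating function.
  let ρ : ℕ → ContDiffBump (0 : ℝ) := fun n =>
    ⟨1 / (n + 2), 1 / (n + 1), by positivity, by gcongr; norm_num⟩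
  have hr : Tendsto (fun n => (ρ n).rOut) atTop (𝓝 0) := tendsto_one_div_add_atTop_nhds_zero_nat
  have hr1 : ∀ n, (ρ n).rOut ≤ 1 := fun n => by
    change 1 / ((n : ℝ) + 1) ≤ 1
    rw [div_le_one (by positivity)]; linarith [n.cast_nonneg (α := ℝ)]
  have hint : ∀ (n : ℕ) (c : ℝ), Integrable fun x => lam.toFun x * (ρ n).normed volume (x - c) := by
    intro n c
    refine Continuous.integrable_of_hasCompactSupport ?_ ?_
    · exact lam.continuous_toFun.mul ((ρ n).continuous_normed.comp (by fun_prop))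
    · exact ((ρ n).hasCompactSupport_normed.comp_homeomorph (Homeomorph.subRight c)).mul_left
  -- The smooth indicator has as derivative a bump at a minus a bump at b. Testing the weak
  -- derivative against it yields both limits, this one and `h2`.
  have h1 : Tendsto (fun n => ∫ x, lam.toFun x * _root_.deriv (smoothIndicator (ρ n) a b) x) atTop
      (𝓝 (lam.toFun a - lam.toFun b)) := by
    refine ((tendsto_integral_normed_mul hr lam.continuous_toFun a).sub
      (tendsto_integral_normed_mul hr lam.continuous_toFun b)).congr fun n => ?_
    rw [← integral_sub (hint n a) (hint n b)]
    refine integral_congr_ae (Eventually.of_forall fun x => ?_)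
    simp only [smoothIndicator.deriv_eq]; ring
  have h2 : Tendsto (fun n => ∫ x, lam.deriv x * smoothIndicator (ρ n) a b x) atTop
      (𝓝 (∫ x, (Set.Ioc a b).indicator lam.deriv x)) := by
    refine tendsto_integral_of_dominated_convergence
      (fun x => (Set.Icc (a - 1) (b + 1)).indicator (fun x => |lam.deriv x|) x) ?_ ?_ ?_ ?_
    · intro n
      exact lam.memLp_deriv.1.mul (smoothIndicator.contDiff _ _ _).continuous.aestronglyMeasurable
    · rw [integrable_indicator_iff measurableSet_Icc]
      exact ((lam.memLp_deriv.locallyIntegrable (by norm_num)).integrableOn_isCompact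
        isCompact_Icc).norm
    · intro n
      refine Eventually.of_forall fun x => ?_
      by_cases hx : x ∈ Set.Icc (a - 1) (b + 1)
      · rw [Set.indicator_of_mem hx, norm_mul, Real.norm_eq_abs, Real.norm_eq_abs,
          abs_of_nonneg (smoothIndicator.nonneg hab x)]
        exact mul_le_of_le_one_right (abs_nonneg _) (smoothIndicator.le_one hab x)
      · rw [Set.indicator_of_notMem hx, smoothIndicator.eq_zero_of_le hab]
        · simp
        · rw [Set.mem_Icc, not_and_or, not_le, not_le] at hx
          rcases hx with hx | hx
          · left; linarith [hr1 n]
          · right; linarith [hr1 n]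
    · have hne : ∀ᵐ x : ℝ, x ≠ a ∧ x ≠ b := by
        rw [eventually_and]
        exact ⟨Measure.ae_ne volume a, Measure.ae_ne volume b⟩
      filter_upwards [hne] with x hx
      by_cases hx1 : x ∈ Set.Ioo a b
      · rw [Set.indicator_of_mem (Set.Ioo_subset_Ioc_self hx1)]
        refine tendsto_const_nhds.congr' ?_
        filter_upwards [hr.eventually_le_const (sub_pos.2 hx1.1),
          hr.eventually_le_const (sub_pos.2 hx1.2)] with n h3 h4
        rw [smoothIndicator.eq_one (by linarith) (by linarith), mul_one]
      · have hx2 : x < a ∨ b < x := by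
          by_contra h
          rw [not_or, not_lt, not_lt] at h
          exact hx1 ⟨lt_of_le_of_ne h.1 (Ne.symm hx.1), lt_of_le_of_ne h.2 hx.2⟩
        rw [Set.indicator_of_notMem (fun h => by
          rcases hx2 with h2 | h2
          · linarith [h.1]
          · linarith [h.2])]
        refine tendsto_const_nhds.congr' ?_
        rcases hx2 with h2 | h2
        · filter_upwards [hr.eventually_le_const (sub_pos.2 h2)] with n h3
          rw [smoothIndicator.eq_zero_of_le hab (Or.inl (by linarith)), mul_zero]
        · filter_upwards [hr.eventually_le_const (sub_pos.2 h2)] with n h3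
          rw [smoothIndicator.eq_zero_of_le hab (Or.inr (by linarith)), mul_zero]
  have h3 := tendsto_nhds_unique h1 (h2.neg.congr fun n =>
    (lam.weak_deriv _ (smoothIndicator.contDiff _ _ _) (smoothIndicator.hasCompactSupport hab)).symm)
  rw [integral_indicator measurableSet_Ioc, ← intervalIntegral.integral_of_le hab] at h3
  linarith

/-! ### Local Sobolev bounds and finiteness of τ -/

/-- Cauchy–Schwarz on an interval. -/
theorem sq_intervalIntegral_le {v : ℝ → ℝ} {a b : ℝ} (hab : a ≤ b)
    (hv : IntervalIntegrable v volume a b) (hv2 : IntervalIntegrable (fun x => v x ^ 2) volume a b) :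
    (∫ x in a..b, v x) ^ 2 ≤ (b - a) * ∫ x in a..b, v x ^ 2 := by
  rcases hab.eq_or_lt with rfl | hab'
  · simp
  -- The mean of `v`: the inequality says that the variance is nonnegative.
  set m := (∫ x in a..b, v x) / (b - a) with hm
  have h : 0 ≤ ∫ x in a..b, (v x - m) ^ 2 :=
    intervalIntegral.integral_nonneg hab fun _ _ => sq_nonneg _
  have h2 : ∫ x in a..b, (v x - m) ^ 2 =
      (∫ x in a..b, v x ^ 2) - 2 * m * (∫ x in a..b, v x) + (b - a) * m ^ 2 := by
    have : ∀ x, (v x - m) ^ 2 = v x ^ 2 - 2 * m * v x + m ^ 2 := fun x => by ring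
    simp_rw [this]
    rw [intervalIntegral.integral_add (hv2.sub (hv.const_mul _)) (by simp),
      intervalIntegral.integral_sub hv2 (hv.const_mul _), intervalIntegral.integral_const_mul]
    simp
  have h3 : (∫ x in a..b, v x) = (b - a) * m := by rw [hm]; field_simp [(sub_pos.2 hab').ne']
  rw [h2, h3] at h
  rw [h3]
  nlinarith [mul_nonneg (sub_nonneg.2 hab) h]

theorem MemLp.intervalIntegrable_sq {v : ℝ → ℝ} (hv : MemLp v 2 (volume : Measure ℝ)) (a b : ℝ) :
    IntervalIntegrable (fun x => v x ^ 2) volume a b :=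
  (hv.integrable_sq).intervalIntegrable

/-- Write f(t) = f(u) − ∫ v over [t, u], square, and average over u in [t, t + 1]. -/
theorem sq_le_two_mul_integral_add {f v : ℝ → ℝ} (hf : MemLp f 2 (volume : Measure ℝ))
    (hv : MemLp v 2 (volume : Measure ℝ)) (h : ∀ a b, f b - f a = ∫ x in a..b, v x) (t : ℝ) :
    f t ^ 2 ≤ 2 * (∫ x in t..t + 1, f x ^ 2) + 2 * ∫ x in t..t + 1, v x ^ 2 := by
  set D := ∫ x in t..t + 1, v x ^ 2
  have h1 : ∀ u ∈ Set.Icc t (t + 1), f t ^ 2 ≤ 2 * f u ^ 2 + 2 * D := by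
    intro u hu
    have h2 := sq_intervalIntegral_le hu.1 (MemLp.intervalIntegrable_of_two hv t u)
      (MemLp.intervalIntegrable_sq hv t u)
    have h3 : ∫ x in t..u, v x ^ 2 ≤ D :=
      intervalIntegral.integral_mono_interval le_rfl hu.1 hu.2
        (Eventually.of_forall fun _ => sq_nonneg _) (MemLp.intervalIntegrable_sq hv _ _)
    have h4 : 0 ≤ ∫ x in t..u, v x ^ 2 := intervalIntegral.integral_nonneg hu.1 fun _ _ => sq_nonneg _
    have h5 : (u - t) * ∫ x in t..u, v x ^ 2 ≤ D := by nlinarith [hu.1, hu.2]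
    rw [← h t u] at h2
    nlinarith [sq_nonneg (f u + (f u - f t))]
  have h2 := intervalIntegral.integral_mono_on (μ := volume) (by linarith : t ≤ t + 1)
    (f := fun _ => f t ^ 2) (g := fun u => 2 * f u ^ 2 + 2 * D) (by simp)
    (((MemLp.intervalIntegrable_sq hf _ _).const_mul _).add (by simp)) h1
  rw [intervalIntegral.integral_add ((MemLp.intervalIntegrable_sq hf _ _).const_mul _) (by simp),
    intervalIntegral.integral_const_mul] at h2
  simpa using h2

theorem summable_integral_sq_shift {v : ℝ → ℝ} (hv : MemLp v 2 (volume : Measure ℝ)) (t : ℝ) :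
    Summable fun k : ℤ => ∫ x in (t - k)..(t - k) + 1, v x ^ 2 := by
  have h := hasSum_integral_iUnion (μ := (volume : Measure ℝ)) (f := fun x => v x ^ 2)
    (s := fun n : ℤ => Set.Ioc (t + n) (t + n + 1)) (fun _ => measurableSet_Ioc)
    (Set.pairwise_disjoint_Ioc_add_intCast t) hv.integrable_sq.integrableOn
  refine (h.summable.comp_injective neg_injective).congr fun k => ?_
  rw [intervalIntegral.integral_of_le (by linarith)]
  simp [sub_eq_add_neg]

/-- The local bound is summed over t − k, whose unit intervals tile the line. Square summability
makes ∑ cₖ λ(t − k) converge at every t. -/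
theorem SobolevH1.summable_sq (lam : SobolevH1) (t : ℝ) :
    Summable fun k : ℤ => lam.toFun (t - k) ^ 2 := by
  refine Summable.of_nonneg_of_le (fun _ => sq_nonneg _) (fun k => sq_le_two_mul_integral_add
    lam.memLp_toFun lam.memLp_deriv lam.sub_eq_integral (t - k)) ?_
  exact ((summable_integral_sq_shift lam.memLp_toFun t).mul_left 2).add
    ((summable_integral_sq_shift lam.memLp_deriv t).mul_left 2)

/-- If τ = ∞ then λ' = 0, so λ is constant; its values at the integers are square summable, so λ =
0, against the lower Riesz bound. -/
theorem SobolevH1.IsGenerator.tau_lt_top {lam : SobolevH1} (hlam : lam.IsGenerator) :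
    lam.tau < ⊤ := by
  rw [lt_top_iff_ne_top]
  intro h
  have h0 := hlam.deriv_toLp_eq_zero_of_tau_eq_top h
  have h1 : lam.deriv =ᵐ[volume] 0 := by
    have := lam.memLp_deriv.coeFn_toLp
    rw [h0] at this
    exact this.symm.trans (Lp.coeFn_zero ℝ 2 volume)
  have h2 : ∀ x, lam.toFun x = lam.toFun 0 := by
    intro x
    have := lam.sub_eq_integral 0 x
    rw [intervalIntegral.integral_congr_ae (g := fun _ => (0 : ℝ))
      (h1.mono fun x hx _ => by simpa using hx)] at this
    simp only [intervalIntegral.integral_zero] at this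
    linarith
  have h3 := lam.summable_sq 0
  simp_rw [h2] at h3
  have h4 : lam.toFun 0 ^ 2 = 0 := (summable_const_iff _).1 h3
  have h5 : lam.toFun = 0 := funext fun x => by rw [h2]; exact pow_eq_zero_iff two_ne_zero |>.1 h4
  obtain ⟨A, B, hA, -, hAB⟩ := hlam.exists_riesz_bounds
  have h6 : lam.memLp_toFun.toLp lam.toFun = 0 := by
    refine Lp.ext ?_
    filter_upwards [lam.memLp_toFun.coeFn_toLp, Lp.coeFn_zero ℝ 2 (volume : Measure ℝ)] with x h6 h7
    rw [h6, h7, h5]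
  have := (hAB {0} 1).1
  simp only [gen, h6, map_zero, smul_zero, Finset.sum_const_zero, norm_zero, Finset.sum_singleton,
    Pi.one_apply] at this
  nlinarith [sq_pos_of_pos hA]

/-! ### Wirtinger's inequality with the sharp constant -/

theorem lintegral_cos_Ioo {α x : ℝ} (hα : 0 < α) (hx : 0 ≤ x) (hx' : α * x ≤ Real.pi / 2) :
    ∫⁻ y in Set.Ioo 0 x, ENNReal.ofReal (Real.cos (α * y)) =
      ENNReal.ofReal (Real.sin (α * x) / α) := by
  rw [← ofReal_integral_eq_lintegral_ofReal]
  · rw [← integral_Ioc_eq_integral_Ioo, ← intervalIntegral.integral_of_le hx,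
      intervalIntegral.integral_comp_mul_left (fun y => Real.cos y) hα.ne', integral_cos]
    congr 1
    simp [div_eq_inv_mul]
  · exact (Continuous.integrableOn_Icc (by fun_prop)).mono_set Set.Ioo_subset_Icc_self
  · refine (ae_restrict_mem measurableSet_Ioo).mono fun y hy => ?_
    refine Real.cos_nonneg_of_mem_Icc ⟨?_, ?_⟩
    · have := mul_pos hα hy.1
      linarith [Real.pi_pos]
    · exact (mul_le_mul_of_nonneg_left hy.2.le hα.le).trans hx'

theorem lintegral_sin_Ioo {α y L : ℝ} (hα : 0 < α) (hy : 0 ≤ y) (hyL : y ≤ L)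
    (hL : α * L = Real.pi / 2) :
    ∫⁻ x in Set.Ioo y L, ENNReal.ofReal (Real.sin (α * x) / α) =
      ENNReal.ofReal (Real.cos (α * y) / α ^ 2) := by
  rw [← ofReal_integral_eq_lintegral_ofReal]
  · rw [← integral_Ioc_eq_integral_Ioo, ← intervalIntegral.integral_of_le hyL,
      intervalIntegral.integral_div,
      intervalIntegral.integral_comp_mul_left (fun y => Real.sin y) hα.ne', integral_sin, hL,
      Real.cos_pi_div_two]
    congr 1
    rw [smul_eq_mul]
    field_simp
    ring
  · exact (Continuous.integrableOn_Icc (by fun_prop)).mono_set Set.Ioo_subset_Icc_self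
  · refine (ae_restrict_mem measurableSet_Ioo).mono fun x hx => ?_
    refine div_nonneg (Real.sin_nonneg_of_mem_Icc ⟨?_, ?_⟩) hα.le
    · exact mul_nonneg hα.le (hy.trans hx.1.le)
    · have := mul_le_mul_of_nonneg_left hx.2.le hα.le
      linarith [Real.pi_pos]

/-- Cauchy–Schwarz after splitting v as √cos · (v/√cos). -/
theorem sq_lintegral_le_sin_mul {α x : ℝ} (hα : 0 < α) (hx : 0 ≤ x) (hx' : α * x < Real.pi / 2)
    {v : ℝ → ℝ≥0∞} (hv : AEMeasurable v) :
    (∫⁻ y in Set.Ioo 0 x, v y) ^ 2 ≤ ENNReal.ofReal (Real.sin (α * x) / α) *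
      ∫⁻ y in Set.Ioo 0 x, v y ^ 2 * (ENNReal.ofReal (Real.cos (α * y)))⁻¹ := by
  set w : ℝ → ℝ≥0∞ := fun y => ENNReal.ofReal (Real.cos (α * y)) ^ (1 / 2 : ℝ) with hw
  have hwm : Measurable w := by fun_prop
  have hpos : ∀ y ∈ Set.Ioo 0 x, 0 < Real.cos (α * y) := fun y hy => by
    refine Real.cos_pos_of_mem_Ioo ⟨?_, ?_⟩
    · have := mul_pos hα hy.1
      linarith [Real.pi_pos]
    · exact (mul_le_mul_of_nonneg_left hy.2.le hα.le).trans_lt hx'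
  have hw2 : ∀ y, w y ^ (2 : ℝ) = ENNReal.ofReal (Real.cos (α * y)) := fun y => by
    rw [hw, ← ENNReal.rpow_mul]; norm_num
  have h1 := ENNReal.lintegral_mul_le_Lp_mul_Lq (volume.restrict (Set.Ioo 0 x))
    (Real.HolderConjugate.two_two) (f := w) (g := fun y => v y * (w y)⁻¹) hwm.aemeasurable
    (hv.restrict.mul hwm.inv.aemeasurable)
  have h2 : ∫⁻ y in Set.Ioo 0 x, (w * fun y => v y * (w y)⁻¹) y = ∫⁻ y in Set.Ioo 0 x, v y := by
    refine setLIntegral_congr_fun measurableSet_Ioo fun y hy => ?_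
    have h0 : w y ≠ 0 := by
      simp [hw, hpos y hy]
    have ht : w y ≠ ⊤ := by
      simp [hw]
    simp only [Pi.mul_apply]
    rw [mul_left_comm, ENNReal.mul_inv_cancel h0 ht, mul_one]
  have h3 : ∀ y, (v y * (w y)⁻¹) ^ (2 : ℝ) = v y ^ 2 * (ENNReal.ofReal (Real.cos (α * y)))⁻¹ :=
    fun y => by
      rw [ENNReal.mul_rpow_of_nonneg _ _ (by norm_num), ENNReal.inv_rpow, hw2, ENNReal.rpow_two]
  simp_rw [h2, h3, hw2, lintegral_cos_Ioo hα hx hx'.le] at h1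
  refine (pow_le_pow_left' h1 2).trans_eq ?_
  rw [mul_pow, ← ENNReal.rpow_natCast, ← ENNReal.rpow_natCast, ← ENNReal.rpow_mul,
    ← ENNReal.rpow_mul]
  norm_num

/-- Wirtinger's inequality for functions vanishing at one end, by a Schur test. -/
theorem lintegral_sq_lintegral_Ioo_le {L : ℝ} (hL : 0 < L) {v : ℝ → ℝ≥0∞} (hv : Measurable v) :
    ∫⁻ x in Set.Ioo 0 L, (∫⁻ y in Set.Ioo 0 x, v y) ^ 2 ≤
      ENNReal.ofReal ((2 * L / Real.pi) ^ 2) * ∫⁻ y in Set.Ioo 0 L, v y ^ 2 := by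
  -- This α makes cos(αL) = 0. Integrating cos(αy) over y < x gives sin(αx)/α, and integrating that
  -- over x from y to L gives back cos(αy)/α², so the weight cancels and leaves 1/α² = (2L/π)².
  set α := Real.pi / (2 * L) with hα'
  have hα : 0 < α := by positivity
  have hαL : α * L = Real.pi / 2 := by rw [hα']; field_simp
  set V : ℝ → ℝ≥0∞ := fun y => v y ^ 2 * (ENNReal.ofReal (Real.cos (α * y)))⁻¹ with hV
  have hVm : Measurable V := by fun_prop
  set S : ℝ → ℝ≥0∞ := fun x => ENNReal.ofReal (Real.sin (α * x) / α) with hS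
  have hSm : Measurable S := by fun_prop
  calc ∫⁻ x in Set.Ioo 0 L, (∫⁻ y in Set.Ioo 0 x, v y) ^ 2
      ≤ ∫⁻ x in Set.Ioo 0 L, S x * ∫⁻ y in Set.Ioo 0 x, V y := by
        refine setLIntegral_mono' measurableSet_Ioo fun x hx => ?_
        refine sq_lintegral_le_sin_mul hα hx.1.le ?_ hv.aemeasurable
        rw [← hαL]
        exact mul_lt_mul_of_pos_left hx.2 hα
    _ = ∫⁻ x in Set.Ioo 0 L, ∫⁻ y in Set.Ioo 0 L,
          (Set.Ioi y).indicator (fun x => S x * V y) x := by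
        refine setLIntegral_congr_fun measurableSet_Ioo fun x hx => ?_
        rw [← lintegral_const_mul _ hVm, ← lintegral_indicator measurableSet_Ioo,
          ← lintegral_indicator measurableSet_Ioo]
        refine lintegral_congr fun y => ?_
        simp only [Set.indicator, Set.mem_Ioo, Set.mem_Ioi]
        by_cases h1 : 0 < y <;> by_cases h2 : y < x
        · simp [h1, h2, h2.trans hx.2]
        · simp [h2]
        · simp [h1]
        · simp [h1]
    _ = ∫⁻ y in Set.Ioo 0 L, ∫⁻ x in Set.Ioo 0 L,
          (Set.Ioi y).indicator (fun x => S x * V y) x := by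
        refine lintegral_lintegral_swap (Measurable.aemeasurable ?_)
        have : Measurable ({p : ℝ × ℝ | p.2 < p.1}.indicator fun p => S p.1 * V p.2) :=
          ((hSm.comp measurable_fst).mul (hVm.comp measurable_snd)).indicator
            (measurableSet_lt measurable_snd measurable_fst)
        exact this
    _ = ∫⁻ y in Set.Ioo 0 L, ENNReal.ofReal ((2 * L / Real.pi) ^ 2) * v y ^ 2 := by
        refine setLIntegral_congr_fun measurableSet_Ioo fun y hy => ?_
        rw [lintegral_indicator measurableSet_Ioi, Measure.restrict_restrict measurableSet_Ioi]
        have : Set.Ioi y ∩ Set.Ioo 0 L = Set.Ioo y L := by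
          ext x
          simp only [Set.mem_inter_iff, Set.mem_Ioi, Set.mem_Ioo]
          exact ⟨fun h => ⟨h.1, h.2.2⟩, fun h => ⟨h.1, hy.1.trans h.1, h.2⟩⟩
        rw [this, lintegral_mul_const _ hSm, lintegral_sin_Ioo hα hy.1.le hy.2.le hαL, hV]
        have hc : 0 < Real.cos (α * y) := by
          refine Real.cos_pos_of_mem_Ioo ⟨?_, ?_⟩
          · have := mul_pos hα hy.1
            linarith [Real.pi_pos]
          · rw [← hαL]
            exact mul_lt_mul_of_pos_left hy.2 hα
        have hc' : ENNReal.ofReal (Real.cos (α * y)) ≠ 0 := by simpa using hc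
        rw [show Real.cos (α * y) / α ^ 2 = (2 * L / Real.pi) ^ 2 * Real.cos (α * y) by
          rw [hα']; field_simp]
        rw [ENNReal.ofReal_mul (by positivity)]
        simp only
        rw [mul_comm (v y ^ 2), mul_assoc, ← mul_assoc (ENNReal.ofReal (Real.cos (α * y))),
          ENNReal.mul_inv_cancel hc' (by finiteness), one_mul]
    _ = _ := lintegral_const_mul' _ _ (by finiteness)

/-- Wirtinger's inequality on `[0, L]` for the primitive vanishing at `0`. -/
theorem integral_sq_primitive_le {v F : ℝ → ℝ} (hv : MemLp v 2 (volume : Measure ℝ)) {L : ℝ}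
    (hL : 0 < L) (hF : Continuous F) (hFv : ∀ x, F x = ∫ y in (0 : ℝ)..x, v y) :
    ∫ x in (0 : ℝ)..L, F x ^ 2 ≤ (2 * L / Real.pi) ^ 2 * ∫ x in (0 : ℝ)..L, v x ^ 2 := by
  obtain ⟨v', hv'm, hv'⟩ := hv.1
  have key := lintegral_sq_lintegral_Ioo_le hL (v := fun y => ‖v' y‖ₑ) hv'm.measurable.enorm
  have hI : ∀ g : ℝ → ℝ, (∫⁻ x in Set.Ioo 0 L, ‖g x‖ₑ ^ 2) =
      ∫⁻ x in Set.Ioo 0 L, ENNReal.ofReal (g x ^ 2) := fun g => by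
    refine lintegral_congr fun x => ?_
    rw [← ofReal_norm, ← ENNReal.ofReal_pow (norm_nonneg _), Real.norm_eq_abs, sq_abs]
  have hvi : IntegrableOn (fun x => v x ^ 2) (Set.Ioo 0 L) := hv.integrable_sq.integrableOn
  have hFi : IntegrableOn (fun x => F x ^ 2) (Set.Ioo 0 L) :=
    (Continuous.integrableOn_Icc (by fun_prop)).mono_set Set.Ioo_subset_Icc_self
  have h1 : ∫⁻ x in Set.Ioo 0 L, ‖F x‖ₑ ^ 2 ≤
      ∫⁻ x in Set.Ioo 0 L, (∫⁻ y in Set.Ioo 0 x, ‖v' y‖ₑ) ^ 2 := by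
    refine setLIntegral_mono' measurableSet_Ioo fun x hx => ?_
    gcongr
    rw [hFv, intervalIntegral.integral_of_le hx.1.le, integral_Ioc_eq_integral_Ioo]
    refine (enorm_integral_le_lintegral_enorm _).trans_eq ?_
    exact lintegral_congr_ae (ae_restrict_of_ae (hv'.mono fun y hy => by simp only [hy]))
  have h2 : ∫⁻ x in Set.Ioo 0 L, ‖v' x‖ₑ ^ 2 = ∫⁻ x in Set.Ioo 0 L, ‖v x‖ₑ ^ 2 :=
    lintegral_congr_ae (ae_restrict_of_ae (hv'.mono fun y hy => by simp only [hy]))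
  have h3 := h1.trans key
  rw [h2, hI, hI, ← ofReal_integral_eq_lintegral_ofReal hFi
    (Eventually.of_forall fun _ => sq_nonneg _), ← ofReal_integral_eq_lintegral_ofReal hvi
    (Eventually.of_forall fun _ => sq_nonneg _), ← ENNReal.ofReal_mul (by positivity),
    ENNReal.ofReal_le_ofReal_iff
      (mul_nonneg (by positivity) (integral_nonneg fun _ => sq_nonneg _))] at h3
  rwa [intervalIntegral.integral_of_le hL.le, intervalIntegral.integral_of_le hL.le,
    integral_Ioc_eq_integral_Ioo, integral_Ioc_eq_integral_Ioo]

/-- `∫ₐᵇ (f - f((a+b)/2))² ≤ ((b-a)/π)² ∫ₐᵇ f'²`. -/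
theorem integral_sq_sub_midpoint_le {f v : ℝ → ℝ} (hv : MemLp v 2 (volume : Measure ℝ))
    (hf : Continuous f) (h : ∀ a b, f b - f a = ∫ x in a..b, v x) {a b : ℝ} (hab : a < b) :
    ∫ x in a..b, (f x - f ((a + b) / 2)) ^ 2 ≤ ((b - a) / Real.pi) ^ 2 * ∫ x in a..b, v x ^ 2 := by
  set m := (a + b) / 2 with hm
  set L := (b - a) / 2 with hL'
  have hL : 0 < L := by rw [hL']; linarith
  have hfi : ∀ c d, IntervalIntegrable (fun x => (f x - f m) ^ 2) volume c d := fun c d =>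
    Continuous.intervalIntegrable (by fun_prop) _ _
  -- Both halves are run outwards from the midpoint, where the function vanishes; the half length
  -- turns 2L/π into (b − a)/π.
  have h1 := integral_sq_primitive_le (v := fun x => v (m + x)) (F := fun x => f (m + x) - f m)
    (hv.comp_measurePreserving (measurePreserving_add_left volume m)) hL (by fun_prop) (fun x => by
      rw [h, intervalIntegral.integral_comp_add_left (fun x => v x), add_zero])
  have h2 := integral_sq_primitive_le (v := fun x => - v (m - x)) (F := fun x => f (m - x) - f m)
    (hv.comp_measurePreserving (Measure.measurePreserving_sub_left volume m)).neg hL (by fun_prop)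
    (fun x => by
      rw [h, intervalIntegral.integral_neg, intervalIntegral.integral_comp_sub_left (fun x => v x),
        sub_zero, intervalIntegral.integral_symm])
  simp_rw [neg_sq] at h2
  rw [intervalIntegral.integral_comp_add_left (fun x => (f x - f m) ^ 2),
    intervalIntegral.integral_comp_add_left (fun x => v x ^ 2)] at h1
  rw [intervalIntegral.integral_comp_sub_left (fun x => (f x - f m) ^ 2),
    intervalIntegral.integral_comp_sub_left (fun x => v x ^ 2)] at h2
  have e1 : m + L = b := by rw [hm, hL']; ring
  have e2 : m - L = a := by rw [hm, hL']; ring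
  rw [add_zero, e1] at h1
  rw [sub_zero, e2] at h2
  rw [← intervalIntegral.integral_add_adjacent_intervals (hfi a m) (hfi m b),
    ← intervalIntegral.integral_add_adjacent_intervals (MemLp.intervalIntegrable_sq hv a m)
      (MemLp.intervalIntegrable_sq hv m b)]
  have e3 : 2 * L = b - a := by rw [hL']; ring
  rw [e3] at h1 h2
  linarith

/-! ### Synthesis from square-summable coefficients and completeness of V²(λ) -/

theorem hasSum_sq_lp {ι : Type*} (c : lp (fun _ : ι => ℝ) 2) :
    HasSum (fun k => c k ^ 2) (‖c‖ ^ 2) := by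
  have := lp.hasSum_norm (by norm_num) c
  simpa using this

/-- Cauchy criterion: finite sums far out are controlled by the tails of `w`. It serves for the
series in λ, in λ' and for Z. -/
theorem summable_smul_of_norm_sum_sq_le {ι E : Type*} [NormedAddCommGroup E] [NormedSpace ℝ E]
    [CompleteSpace E] {u : ι → E} {c : ι → ℝ} {B : ℝ} {w : ι → ℝ} (hw : Summable w)
    (h : ∀ s : Finset ι, ‖∑ k ∈ s, c k • u k‖ ^ 2 ≤ B ^ 2 * ∑ k ∈ s, w k) :
    Summable fun k => c k • u k := by
  rw [summable_iff_vanishing_norm]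
  intro ε hε
  obtain ⟨s, hs⟩ := summable_iff_vanishing_norm.1 hw (ε ^ 2 / (B ^ 2 + 1)) (by positivity)
  refine ⟨s, fun t ht => ?_⟩
  have h1 := hs t ht
  rw [Real.norm_eq_abs] at h1
  have h2 : ∑ k ∈ t, w k ≤ ε ^ 2 / (B ^ 2 + 1) := (le_abs_self _).trans h1.le
  refine lt_of_pow_lt_pow_left₀ 2 hε.le ((h t).trans_lt ?_)
  have h3 : B ^ 2 * ∑ k ∈ t, w k ≤ B ^ 2 * (ε ^ 2 / (B ^ 2 + 1)) := by gcongr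
  refine h3.trans_lt ?_
  rw [mul_div_assoc', div_lt_iff₀ (by positivity)]
  nlinarith [sq_pos_of_pos hε]

/-- Some sequence of finite partial sums converges almost everywhere to the L² limit, and along it
the pointwise sums converge to `f`. -/
theorem coeFn_eq_of_hasSum {ι : Type*} [Countable ι] {u : ι → Lp ℝ 2 (volume : Measure ℝ)}
    {g : ι → ℝ → ℝ} (hug : ∀ k, u k =ᵐ[volume] g k) {F : Lp ℝ 2 (volume : Measure ℝ)}
    (hF : HasSum u F) {f : ℝ → ℝ} (hf : ∀ t, HasSum (fun k => g k t) (f t)) : F =ᵐ[volume] f := by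
  obtain ⟨ns, hns, h⟩ := (tendstoInMeasure_of_tendsto_Lp hF).exists_seq_tendsto_ae'
  have h1 : ∀ᵐ x : ℝ, ∀ i, (∑ k ∈ ns i, u k : Lp ℝ 2 (volume : Measure ℝ)) x
      = ∑ k ∈ ns i, g k x := by
    rw [ae_all_iff]
    intro i
    have h2 : ∀ᵐ x : ℝ, ∀ k, u k x = g k x := by
      rw [ae_all_iff]; exact hug
    filter_upwards [Lp.coeFn_finsetSum (ns i) u, h2] with x h3 h4
    rw [h3, Finset.sum_apply]
    exact Finset.sum_congr rfl fun k _ => h4 k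
  filter_upwards [h, h1] with x h2 h3
  refine tendsto_nhds_unique (h2.congr h3) ((hf x).comp hns)

theorem Lp.sq_norm_eq_integral (F : Lp ℝ 2 (volume : Measure ℝ)) : ‖F‖ ^ 2 = ∫ x, F x ^ 2 := by
  rw [← real_inner_self_eq_norm_sq, L2.inner_def]
  simp [sq]

theorem integral_translateL2 {h : ℝ → ℝ} (hh : MemLp h 2 (volume : Measure ℝ)) (k a b : ℝ) :
    ∫ x in a..b, translateL2 ℝ k (hh.toLp h) x = ∫ x in (a - k)..(b - k), h x := by
  rw [← intervalIntegral.integral_comp_sub_right (fun x => h x)]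
  refine intervalIntegral.integral_congr_ae ?_
  have h0 := (measurePreserving_sub_right (volume : Measure ℝ) k).quasiMeasurePreserving.ae
    hh.coeFn_toLp
  filter_upwards [coeFn_translateL2 k (hh.toLp h), h0] with x h1 h2 _
  rw [h1, h2]

/-- Integration over a bounded interval is the inner product with its indicator, hence continuous on
L². -/
theorem hasSum_setIntegral_Lp {ι : Type*} {u : ι → Lp ℝ 2 (volume : Measure ℝ)}
    {F : Lp ℝ 2 (volume : Measure ℝ)} (hF : HasSum u F) (a b : ℝ) :
    HasSum (fun k => ∫ x in a..b, u k x) (∫ x in a..b, F x) := by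
  have h : ∀ a b : ℝ, HasSum (fun k => ∫ x in Set.Ioc a b, u k x) (∫ x in Set.Ioc a b, F x) := by
    intro a b
    have hμ : (volume : Measure ℝ) (Set.Ioc a b) ≠ ⊤ := by simp
    simp_rw [← L2.inner_indicatorConstLp_one (𝕜 := ℝ) measurableSet_Ioc hμ]
    exact hF.mapL (innerSL ℝ (indicatorConstLp 2 measurableSet_Ioc hμ (1 : ℝ)))
  exact (h a b).sub (h b a)

namespace SobolevH1

variable {lam : SobolevH1}

theorem coeFn_gen (lam : SobolevH1) (k : ℤ) :
    lam.gen k =ᵐ[volume] fun t => lam.toFun (t - k) := by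
  have h0 := (measurePreserving_sub_right (volume : Measure ℝ) k).quasiMeasurePreserving.ae
    lam.memLp_toFun.coeFn_toLp
  filter_upwards [coeFn_translateL2 k (lam.memLp_toFun.toLp lam.toFun), h0] with x h1 h2
  rw [gen, h1, h2]

theorem IsGenerator.summable_gen (hlam : lam.IsGenerator) (c : lp (fun _ : ℤ => ℝ) 2) :
    Summable fun k => c k • lam.gen k := by
  obtain ⟨A, B, -, -, h⟩ := hlam.exists_riesz_bounds
  exact summable_smul_of_norm_sum_sq_le (hasSum_sq_lp c).summable fun s => (h s c).2

theorem IsGenerator.summable_genDeriv (hlam : lam.IsGenerator) (c : lp (fun _ : ℤ => ℝ) 2) :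
    Summable fun k => c k • lam.genDeriv k := by
  obtain ⟨A, B, -, -, h⟩ := hlam.exists_riesz_bounds
  have hτ : 0 < lam.tau.toReal := ENNReal.toReal_pos hlam.tau_pos.ne' hlam.tau_lt_top.ne
  refine summable_smul_of_norm_sum_sq_le (B := Real.pi / lam.tau.toReal * B)
    (hasSum_sq_lp c).summable fun s => ?_
  have h1 := tau_mul_norm_genDeriv_le hlam.tau_lt_top.ne s c
  have h2 : ‖∑ k ∈ s, c k • lam.genDeriv k‖ ≤
      Real.pi / lam.tau.toReal * ‖∑ k ∈ s, c k • lam.gen k‖ := by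
    rw [div_mul_eq_mul_div, le_div_iff₀ hτ]; linarith
  calc _ ≤ (Real.pi / lam.tau.toReal * ‖∑ k ∈ s, c k • lam.gen k‖) ^ 2 := by gcongr
    _ = (Real.pi / lam.tau.toReal) ^ 2 * ‖∑ k ∈ s, c k • lam.gen k‖ ^ 2 := by ring
    _ ≤ (Real.pi / lam.tau.toReal) ^ 2 * (B ^ 2 * ∑ k ∈ s, c k ^ 2) := by
      gcongr; exact (h s c).2
    _ = _ := by ring

theorem summable_mul_toFun (lam : SobolevH1) (c : lp (fun _ : ℤ => ℝ) 2) (t : ℝ) :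
    Summable fun k : ℤ => c k * lam.toFun (t - k) := by
  refine Summable.of_norm_bounded ((hasSum_sq_lp c).summable.add (lam.summable_sq t)) fun k => ?_
  rw [Real.norm_eq_abs, abs_le]
  constructor <;> nlinarith [sq_nonneg (c k + lam.toFun (t - k)), sq_nonneg (c k - lam.toFun (t - k)),
    sq_nonneg (c k), sq_nonneg (lam.toFun (t - k))]

/-- The synthesis operator `c ↦ ∑ cₖ λ(· - k)` from `ℓ²(ℤ)` to `L²(ℝ)`. -/
def IsGenerator.synthesis (hlam : lam.IsGenerator) :
    lp (fun _ : ℤ => ℝ) 2 →ₗ[ℝ] Lp ℝ 2 (volume : Measure ℝ) where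
  toFun c := ∑' k, c k • lam.gen k
  map_add' c d := by
    rw [← (hlam.summable_gen c).tsum_add (hlam.summable_gen d)]
    exact tsum_congr fun k => by simp [add_smul]
  map_smul' a c := by
    rw [RingHom.id_apply, ← (hlam.summable_gen c).tsum_const_smul]
    exact tsum_congr fun k => by simp [mul_smul]

theorem IsGenerator.hasSum_synthesis (hlam : lam.IsGenerator) (c : lp (fun _ : ℤ => ℝ) 2) :
    HasSum (fun k => c k • lam.gen k) (hlam.synthesis c) := (hlam.summable_gen c).hasSum

theorem IsGenerator.exists_synthesis_bounds (hlam : lam.IsGenerator) :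
    ∃ A B : ℝ, 0 < A ∧ 0 < B ∧ ∀ c, A * ‖c‖ ≤ ‖hlam.synthesis c‖ ∧
      ‖hlam.synthesis c‖ ≤ B * ‖c‖ := by
  obtain ⟨A, B, hA, hB, h⟩ := hlam.exists_riesz_bounds
  refine ⟨A, B, hA, hB, fun c => ?_⟩
  have h1 := (hlam.hasSum_synthesis c).norm.pow 2
  have h2 := hasSum_sq_lp c
  constructor
  · rw [← pow_le_pow_iff_left₀ (by positivity) (by positivity) two_ne_zero, mul_pow]
    exact le_of_tendsto_of_tendsto' (h2.const_mul (A ^ 2)) h1 fun s => (h s c).1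
  · rw [← pow_le_pow_iff_left₀ (by positivity) (by positivity) two_ne_zero, mul_pow]
    exact le_of_tendsto_of_tendsto' h1 (h2.const_mul (B ^ 2)) fun s => (h s c).2

theorem IsGenerator.coeFn_synthesis (hlam : lam.IsGenerator) {c : lp (fun _ : ℤ => ℝ) 2}
    {f : ℝ → ℝ} (hf : ∀ t : ℝ, HasSum (fun k : ℤ => c k * lam.toFun (t - k)) (f t)) :
    hlam.synthesis c =ᵐ[volume] f := by
  refine coeFn_eq_of_hasSum (g := fun k t => c k * lam.toFun (t - k)) (fun k => ?_)
    (hlam.hasSum_synthesis c) hf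
  filter_upwards [Lp.coeFn_smul (c k) (lam.gen k), lam.coeFn_gen k] with x h1 h2
  rw [h1, Pi.smul_apply, h2, smul_eq_mul]

theorem IsGenerator.range_synthesis (hlam : lam.IsGenerator) :
    LinearMap.range hlam.synthesis = lam.V2L := by
  ext F
  constructor
  · rintro ⟨c, rfl⟩
    exact ⟨_, ⟨c, fun t => (lam.summable_mul_toFun c t).hasSum⟩,
      hlam.coeFn_synthesis fun t => (lam.summable_mul_toFun c t).hasSum⟩
  · rintro ⟨f, ⟨c, hc⟩, hf⟩
    exact ⟨c, Lp.ext ((hlam.coeFn_synthesis hc).trans hf.symm)⟩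

/-- By the lower Riesz bound the synthesis map is antilipschitz, so its range is complete. -/
theorem IsGenerator.isComplete_V2L (hlam : lam.IsGenerator) :
    IsComplete (lam.V2L : Set (Lp ℝ 2 (volume : Measure ℝ))) := by
  obtain ⟨A, B, hA, hB, h⟩ := hlam.exists_synthesis_bounds
  rw [← hlam.range_synthesis, LinearMap.coe_range]
  have h1 : AntilipschitzWith (Real.toNNReal A⁻¹) hlam.synthesis :=
    AddMonoidHomClass.antilipschitz_of_bound hlam.synthesis fun c => by
      rw [Real.coe_toNNReal _ (by positivity), inv_mul_eq_div, le_div_iff₀ hA, mul_comm]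
      exact (h c).1
  have h3 : UniformContinuous hlam.synthesis :=
    (hlam.synthesis.mkContinuous B fun c => (h c).2).uniformContinuous
  exact h1.isComplete_range h3

theorem IsGenerator.memLp_of_mem_V2 (hlam : lam.IsGenerator) {f : ℝ → ℝ} (hf : f ∈ lam.V2) :
    MemLp f 2 (volume : Measure ℝ) := by
  obtain ⟨c, hc⟩ := hf
  exact (memLp_congr_ae (hlam.coeFn_synthesis hc)).1 (Lp.memLp _)

/-! ### Bernstein's inequality and the reproducing kernel -/

/-- Bernstein's inequality in `V²(λ)`: `τ ‖f'‖ ≤ π ‖f‖`. -/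
theorem IsGenerator.exists_deriv (hlam : lam.IsGenerator) {f : ℝ → ℝ} (hf : f ∈ lam.V2)
    {F : Lp ℝ 2 (volume : Measure ℝ)} (hF : F =ᵐ[volume] f) :
    ∃ D : Lp ℝ 2 (volume : Measure ℝ), (∀ a b, f b - f a = ∫ x in a..b, D x) ∧
      lam.tau.toReal * ‖D‖ ≤ Real.pi * ‖F‖ := by
  obtain ⟨c, hc⟩ := hf
  have hFc : F = hlam.synthesis c := Lp.ext (hF.trans (hlam.coeFn_synthesis hc).symm)
  have hD := (hlam.summable_genDeriv c).hasSum
  -- The derivative is synthesized from λ' with the same coefficients; the primitive identity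
  -- follows by termwise integration, the norm bound as a limit of finite sums.
  refine ⟨∑' k, c k • lam.genDeriv k, fun a b => ?_, ?_⟩
  · have h : ∀ k : ℤ, ∫ x in a..b, (c k • lam.genDeriv k : Lp ℝ 2 (volume : Measure ℝ)) x =
        c k * lam.toFun (b - k) - c k * lam.toFun (a - k) := fun k => by
      rw [intervalIntegral.integral_congr_ae (g := fun x => c k * lam.genDeriv k x)
        ((Lp.coeFn_smul (c k) (lam.genDeriv k)).mono fun x hx _ => by simpa using hx),
        intervalIntegral.integral_const_mul, genDeriv, integral_translateL2, ← lam.sub_eq_integral,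
        mul_sub]
    refine HasSum.unique ((hc b).sub (hc a)) ?_
    simpa only [h] using hasSum_setIntegral_Lp hD a b
  · rw [hFc]
    exact le_of_tendsto_of_tendsto' (hD.norm.const_mul _)
      ((hlam.hasSum_synthesis c).norm.const_mul _)
      fun s => tau_mul_norm_genDeriv_le hlam.tau_lt_top.ne s c

/-- The local Sobolev bound involves ‖f‖ and ‖f'‖, and Bernstein absorbs the latter. -/
theorem IsGenerator.exists_abs_eval_le (hlam : lam.IsGenerator) :
    ∃ C : ℝ, ∀ f ∈ lam.V2, ∀ F : Lp ℝ 2 (volume : Measure ℝ), F =ᵐ[volume] f → ∀ t,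
      |f t| ≤ C * ‖F‖ := by
  have hτ : 0 < lam.tau.toReal := ENNReal.toReal_pos hlam.tau_pos.ne' hlam.tau_lt_top.ne
  refine ⟨√(2 + 2 * (Real.pi / lam.tau.toReal) ^ 2), fun f hf F hF t => ?_⟩
  obtain ⟨D, hD, hDF⟩ := hlam.exists_deriv hf hF
  have hfm := hlam.memLp_of_mem_V2 hf
  have hle : ∀ {g : ℝ → ℝ}, MemLp g 2 (volume : Measure ℝ) →
      ∫ x in t..t + 1, g x ^ 2 ≤ ∫ x, g x ^ 2 := fun hg => by
    rw [intervalIntegral.integral_of_le (by linarith)]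
    exact setIntegral_le_integral hg.integrable_sq (Eventually.of_forall fun _ => sq_nonneg _)
  have h1 := sq_le_two_mul_integral_add hfm (Lp.memLp D) hD t
  have h2 : ∫ x, f x ^ 2 = ‖F‖ ^ 2 := by
    rw [Lp.sq_norm_eq_integral]
    exact integral_congr_ae (hF.mono fun x hx => by simp only [hx])
  have h3 := hle hfm
  have h4 := hle (Lp.memLp D)
  rw [h2] at h3
  rw [← Lp.sq_norm_eq_integral] at h4
  have h5 : ‖D‖ ≤ Real.pi / lam.tau.toReal * ‖F‖ := by
    rw [div_mul_eq_mul_div, le_div_iff₀ hτ]; linarith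
  have h6 : ‖D‖ ^ 2 ≤ (Real.pi / lam.tau.toReal * ‖F‖) ^ 2 := by gcongr
  rw [← pow_le_pow_iff_left₀ (abs_nonneg _) (by positivity) two_ne_zero, sq_abs, mul_pow,
    Real.sq_sqrt (by positivity)]
  rw [mul_pow] at h6
  linarith

/-- The evaluation bound is applied to f − g, whose class is 0. This makes `repr` independent of
choices, so that `eval` is linear. -/
theorem IsGenerator.eq_of_ae_eq (hlam : lam.IsGenerator) {f g : ℝ → ℝ} (hf : f ∈ lam.V2)
    (hg : g ∈ lam.V2) (h : f =ᵐ[volume] g) : f = g := by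
  obtain ⟨C, hC⟩ := hlam.exists_abs_eval_le
  funext t
  have h1 : ((0 : Lp ℝ 2 (volume : Measure ℝ)) : ℝ → ℝ) =ᵐ[volume] f - g := by
    filter_upwards [h, Lp.coeFn_zero ℝ 2 (volume : Measure ℝ)] with x h1 h2
    rw [h2, Pi.sub_apply, h1, sub_self]; rfl
  have := hC (f - g) (lam.V2.sub_mem hf hg) 0 h1 t
  rw [norm_zero, mul_zero] at this
  exact sub_eq_zero.1 (abs_nonpos_iff.1 this)

/-- The representative in `V²(λ)` of a class in `L²(ℝ)`. -/
def IsGenerator.repr (_ : lam.IsGenerator) (F : lam.V2L) : ℝ → ℝ := F.2.choose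

theorem IsGenerator.repr_mem (hlam : lam.IsGenerator) (F : lam.V2L) : hlam.repr F ∈ lam.V2 :=
  F.2.choose_spec.1

theorem IsGenerator.coeFn_repr (hlam : lam.IsGenerator) (F : lam.V2L) :
    (F : Lp ℝ 2 (volume : Measure ℝ)) =ᵐ[volume] hlam.repr F :=
  F.2.choose_spec.2

/-- Evaluation at a point, as a linear form on `V²(λ) ⊆ L²(ℝ)`. -/
def IsGenerator.eval (hlam : lam.IsGenerator) (x : ℝ) : lam.V2L →ₗ[ℝ] ℝ where
  toFun F := hlam.repr F x
  map_add' F G := by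
    refine congrFun (hlam.eq_of_ae_eq (hlam.repr_mem _)
      (lam.V2.add_mem (hlam.repr_mem F) (hlam.repr_mem G)) ?_) x
    filter_upwards [hlam.coeFn_repr F, hlam.coeFn_repr G, hlam.coeFn_repr (F + G),
      Lp.coeFn_add (F : Lp ℝ 2 (volume : Measure ℝ)) G] with x h1 h2 h3 h4
    rw [← h3, Pi.add_apply, ← h1, ← h2]
    exact h4
  map_smul' a F := by
    refine congrFun (hlam.eq_of_ae_eq (hlam.repr_mem _)
      (lam.V2.smul_mem a (hlam.repr_mem F)) ?_) x
    filter_upwards [hlam.coeFn_repr F, hlam.coeFn_repr (a • F),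
      Lp.coeFn_smul a (F : Lp ℝ 2 (volume : Measure ℝ))] with x h1 h3 h4
    rw [← h3, Pi.smul_apply, ← h1]
    exact h4

/-- Riesz representation of the bounded form `eval x` on the complete space `V2L`. -/
theorem IsGenerator.exists_isReproducingKernel (hlam : lam.IsGenerator) :
    ∃ K, lam.IsReproducingKernel K := by
  obtain ⟨C, hC⟩ := hlam.exists_abs_eval_le
  have : CompleteSpace lam.V2L := hlam.isComplete_V2L.completeSpace_coe
  let ev : ℝ → lam.V2L →L[ℝ] ℝ := fun x => (hlam.eval x).mkContinuous C fun F =>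
    hC _ (hlam.repr_mem F) F (hlam.coeFn_repr F) x
  refine ⟨fun x => ((InnerProductSpace.toDual ℝ lam.V2L).symm (ev x) : lam.V2L), fun x =>
    ⟨Subtype.coe_prop _, fun f hf F hF => ?_⟩⟩
  have h1 : hlam.repr ⟨F, f, hf, hF⟩ = f := hlam.eq_of_ae_eq (hlam.repr_mem _) hf
    ((hlam.coeFn_repr ⟨F, f, hf, hF⟩).symm.trans hF)
  rw [real_inner_comm]
  have h2 := InnerProductSpace.toDual_symm_apply (𝕜 := ℝ) (x := (⟨F, f, hf, hF⟩ : lam.V2L)) (y := ev x)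
  rw [Submodule.coe_inner] at h2
  rw [h2]
  exact (congrFun h1 x).symm

end SobolevH1

/-! ### Sampling along a time sequence and the contraction estimate -/

theorem sq_integral_mul_le {α : Type*} [MeasurableSpace α] {μ : Measure α} {f g : α → ℝ}
    (hf : MemLp f 2 μ) (hg : MemLp g 2 μ) :
    (∫ x, f x * g x ∂μ) ^ 2 ≤ (∫ x, f x ^ 2 ∂μ) * ∫ x, g x ^ 2 ∂μ := by
  have hi : ∀ {f g : α → ℝ} (hf : MemLp f 2 μ) (hg : MemLp g 2 μ),
      inner ℝ (hf.toLp f) (hg.toLp g) = ∫ x, f x * g x ∂μ := fun {f g} hf hg => by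
    rw [L2.inner_def]
    refine integral_congr_ae ?_
    filter_upwards [hf.coeFn_toLp, hg.coeFn_toLp] with x h1 h2
    rw [h1, h2]
    simp [mul_comm]
  have h := real_inner_mul_inner_self_le (hf.toLp f) (hg.toLp g)
  simp only [hi] at h
  simpa only [sq] using h

namespace TimeSeq

variable (σ : TimeSeq)

theorem iUnion_Ioc : ⋃ n : ℤ, Set.Ioc (σ.t n) (σ.t (n + 1)) = Set.univ := by
  refine Set.eq_univ_of_forall fun x => Set.mem_iUnion.2 ?_
  obtain ⟨N, hN⟩ := (σ.tendsto_atTop.eventually_ge_atTop x).exists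
  obtain ⟨M, hM⟩ := (σ.tendsto_atBot.eventually_lt_atBot x).exists
  obtain ⟨n, hn, hmax⟩ := Int.exists_greatest_of_bdd (P := fun n => σ.t n < x)
    ⟨N, fun z hz => (σ.strictMono.lt_iff_lt.1 (hz.trans_le hN)).le⟩ ⟨M, hM⟩
  refine ⟨n, hn, ?_⟩
  by_contra h
  have := hmax (n + 1) (not_le.1 h)
  omega

theorem hasSum_integral {g : ℝ → ℝ} (hg : Integrable g) :
    HasSum (fun n => ∫ x in σ.t n..σ.t (n + 1), g x) (∫ x, g x) := by
  have h := hasSum_integral_iUnion (μ := (volume : Measure ℝ)) (f := g)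
    (s := fun n : ℤ => Set.Ioc (σ.t n) (σ.t (n + 1))) (fun _ => measurableSet_Ioc)
    σ.strictMono.monotone.pairwise_disjoint_on_Ioc_succ hg.integrableOn
  rw [σ.iUnion_Ioc, setIntegral_univ] at h
  simpa only [intervalIntegral.integral_of_le (σ.strictMono (lt_add_one _)).le] using h

variable {σ}

theorem s_add_one (n : ℤ) : σ.s (n + 1) = (σ.t n + σ.t (n + 1)) / 2 := by
  simp [s]

theorem sum_integral_sq_le (F : Lp ℝ 2 (volume : Measure ℝ)) (s : Finset ℤ) :
    ∑ n ∈ s, ∫ x in σ.t n..σ.t (n + 1), F x ^ 2 ≤ ‖F‖ ^ 2 := by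
  rw [Lp.sq_norm_eq_integral]
  refine sum_le_hasSum s (fun n _ => ?_) (σ.hasSum_integral (Lp.memLp F).integrable_sq)
  exact intervalIntegral.integral_nonneg (σ.strictMono (lt_add_one _)).le fun _ _ => sq_nonneg _

end TimeSeq

namespace SobolevH1

variable {lam : SobolevH1} {K : ℝ → Lp ℝ 2 (volume : Measure ℝ)} {σ : TimeSeq} {T : ℝ}

theorem continuous_of_sub_eq_integral {f : ℝ → ℝ} {D : Lp ℝ 2 (volume : Measure ℝ)}
    (h : ∀ a b, f b - f a = ∫ x in a..b, D x) : Continuous f := by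
  have h1 : f = fun x => f 0 + ∫ y in (0 : ℝ)..x, D y := funext fun x => by rw [← h]; ring
  rw [h1]
  exact continuous_const.add (intervalIntegral.continuous_primitive
    (fun a b => MemLp.intervalIntegrable_of_two (Lp.memLp D) a b) 0)

theorem integral_sq_sub_sample_le (hT : σ.IsDense T) {f : ℝ → ℝ} {D : Lp ℝ 2 (volume : Measure ℝ)}
    (h : ∀ a b, f b - f a = ∫ x in a..b, D x) (n : ℤ) :
    ∫ x in σ.t n..σ.t (n + 1), (f x - f (σ.s (n + 1))) ^ 2 ≤
      (T / Real.pi) ^ 2 * ∫ x in σ.t n..σ.t (n + 1), D x ^ 2 := by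
  have h0 : σ.t n < σ.t (n + 1) := σ.strictMono (lt_add_one _)
  rw [TimeSeq.s_add_one]
  refine (integral_sq_sub_midpoint_le (Lp.memLp D) (continuous_of_sub_eq_integral h) h h0).trans ?_
  have h1 : 0 ≤ ∫ x in σ.t n..σ.t (n + 1), D x ^ 2 :=
    intervalIntegral.integral_nonneg h0.le fun _ _ => sq_nonneg _
  have h2 : 0 ≤ σ.t (n + 1) - σ.t n := by linarith
  have h3 := hT n
  gcongr

/-- The samples of a function in `V²(λ)` at the midpoints are square summable. -/
theorem sum_length_mul_sample_sq_le (hT : σ.IsDense T) {f : ℝ → ℝ}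
    {F D : Lp ℝ 2 (volume : Measure ℝ)} (hF : F =ᵐ[volume] f)
    (h : ∀ a b, f b - f a = ∫ x in a..b, D x) (s : Finset ℤ) :
    ∑ n ∈ s, (σ.t (n + 1) - σ.t n) * f (σ.s (n + 1)) ^ 2 ≤
      2 * ((T / Real.pi) ^ 2 * ‖D‖ ^ 2 + ‖F‖ ^ 2) := by
  have h1 : ∀ n, (σ.t (n + 1) - σ.t n) * f (σ.s (n + 1)) ^ 2 ≤
      2 * ((T / Real.pi) ^ 2 * (∫ x in σ.t n..σ.t (n + 1), D x ^ 2) +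
        ∫ x in σ.t n..σ.t (n + 1), F x ^ 2) := by
    intro n
    have h0 : σ.t n ≤ σ.t (n + 1) := (σ.strictMono (lt_add_one _)).le
    have hc := continuous_of_sub_eq_integral h
    have h2 : ∫ x in σ.t n..σ.t (n + 1), F x ^ 2 = ∫ x in σ.t n..σ.t (n + 1), f x ^ 2 :=
      intervalIntegral.integral_congr_ae (hF.mono fun x hx _ => by simp only [hx])
    have h3 := integral_sq_sub_sample_le hT h n
    have i1 : IntervalIntegrable (fun x => 2 * (f x - f (σ.s (n + 1))) ^ 2) volume
      (σ.t n) (σ.t (n + 1)) := Continuous.intervalIntegrable (by fun_prop) _ _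
    have i2 : IntervalIntegrable (fun x => 2 * f x ^ 2) volume
      (σ.t n) (σ.t (n + 1)) := Continuous.intervalIntegrable (by fun_prop) _ _
    have h4 := intervalIntegral.integral_mono_on (μ := volume) h0
      (f := fun _ => f (σ.s (n + 1)) ^ 2)
      (g := fun x => 2 * (f x - f (σ.s (n + 1))) ^ 2 + 2 * f x ^ 2) (by simp) (i1.add i2)
      fun x _ => by nlinarith [sq_nonneg (f x - f (σ.s (n + 1)) + f x)]
    rw [intervalIntegral.integral_add i1 i2, intervalIntegral.integral_const_mul,
      intervalIntegral.integral_const_mul, intervalIntegral.integral_const, smul_eq_mul] at h4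
    rw [h2]
    linarith
  refine (Finset.sum_le_sum fun n _ => h1 n).trans ?_
  rw [← Finset.mul_sum, Finset.sum_add_distrib, ← Finset.mul_sum]
  have h2 := TimeSeq.sum_integral_sq_le (σ := σ) D s
  have h3 := TimeSeq.sum_integral_sq_le (σ := σ) F s
  gcongr

/-- By duality: a finite partial sum X lies in V²(λ), so ‖X‖² is the sum of the coefficients times
the samples of X. Cauchy–Schwarz, with the interval lengths moved onto the samples, bounds ‖X‖⁴ by a
multiple of ‖X‖² ∑ ∫ F², and ‖X‖² is divided out. -/
theorem IsGenerator.summable_Z (hlam : lam.IsGenerator) (hK : lam.IsReproducingKernel K)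
    (hT : σ.IsDense T) (F : Lp ℝ 2 (volume : Measure ℝ)) :
    Summable fun n : ℤ => (∫ u in σ.t n..σ.t (n + 1), F u) • K (σ.s (n + 1)) := by
  have hτ : 0 < lam.tau.toReal := ENNReal.toReal_pos hlam.tau_pos.ne' hlam.tau_lt_top.ne
  refine summable_smul_of_norm_sum_sq_le
    (B := √(2 * ((T / lam.tau.toReal) ^ 2 + 1)))
    (σ.hasSum_integral (Lp.memLp F).integrable_sq).summable fun s => ?_
  set a : ℤ → ℝ := fun n => ∫ u in σ.t n..σ.t (n + 1), F u with ha
  set X := ∑ n ∈ s, a n • K (σ.s (n + 1)) with hX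
  have hXm : X ∈ lam.V2L := Submodule.sum_mem _ fun n _ => Submodule.smul_mem _ _ (hK _).1
  obtain ⟨f, hf, hXf⟩ := hXm
  obtain ⟨D, hD, hDX⟩ := hlam.exists_deriv hf hXf
  have h1 : ‖X‖ ^ 2 = ∑ n ∈ s, a n * f (σ.s (n + 1)) := by
    rw [← real_inner_self_eq_norm_sq]
    nth_rw 2 [hX]
    rw [inner_sum]
    refine Finset.sum_congr rfl fun n _ => ?_
    rw [inner_smul_right, ← (hK _).2 f hf X hXf]
  have h2 : (‖X‖ ^ 2) ^ 2 ≤ (∑ n ∈ s, ∫ x in σ.t n..σ.t (n + 1), F x ^ 2) *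
      ∑ n ∈ s, (σ.t (n + 1) - σ.t n) * f (σ.s (n + 1)) ^ 2 := by
    rw [h1]
    have h0 : ∀ n, σ.t n ≤ σ.t (n + 1) := fun n => (σ.strictMono (lt_add_one _)).le
    refine Finset.sum_sq_le_sum_mul_sum_of_sq_le_mul s (fun n _ => ?_) (fun n _ => ?_) fun n _ => ?_
    · exact intervalIntegral.integral_nonneg (h0 n) fun _ _ => sq_nonneg _
    · exact mul_nonneg (sub_nonneg.2 (h0 n)) (sq_nonneg _)
    · have := sq_intervalIntegral_le (h0 n) (MemLp.intervalIntegrable_of_two (Lp.memLp F) _ _)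
        (MemLp.intervalIntegrable_sq (Lp.memLp F) _ _)
      rw [mul_pow]
      nlinarith [mul_le_mul_of_nonneg_right this (sq_nonneg (f (σ.s (n + 1))))]
  have h3 := sum_length_mul_sample_sq_le hT hXf hD s
  have h4 : (T / Real.pi) ^ 2 * ‖D‖ ^ 2 ≤ (T / lam.tau.toReal) ^ 2 * ‖X‖ ^ 2 := by
    have : ‖D‖ ≤ Real.pi / lam.tau.toReal * ‖X‖ := by
      rw [div_mul_eq_mul_div, le_div_iff₀ hτ]; linarith
    calc (T / Real.pi) ^ 2 * ‖D‖ ^ 2 ≤ (T / Real.pi) ^ 2 * (Real.pi / lam.tau.toReal * ‖X‖) ^ 2 := by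
          gcongr
      _ = _ := by field_simp
  set W := ∑ n ∈ s, ∫ x in σ.t n..σ.t (n + 1), F x ^ 2
  have hW : 0 ≤ W := Finset.sum_nonneg fun n _ => intervalIntegral.integral_nonneg
    (σ.strictMono (lt_add_one _)).le fun _ _ => sq_nonneg _
  rw [Real.sq_sqrt (by positivity)]
  have h5 : (‖X‖ ^ 2) * ‖X‖ ^ 2 ≤ (2 * ((T / lam.tau.toReal) ^ 2 + 1) * W) * ‖X‖ ^ 2 := by
    calc _ = (‖X‖ ^ 2) ^ 2 := by ring
      _ ≤ W * (2 * ((T / lam.tau.toReal) ^ 2 * ‖X‖ ^ 2 + ‖X‖ ^ 2)) :=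
        h2.trans (by gcongr; linarith)
      _ = _ := by ring
  rcases (sq_nonneg ‖X‖).eq_or_lt with h6 | h6
  · rw [← h6]; positivity
  · exact le_of_mul_le_mul_right h5 h6

theorem IsGenerator.Z_sub (hlam : lam.IsGenerator) (hK : lam.IsReproducingKernel K)
    (hT : σ.IsDense T) (F G : Lp ℝ 2 (volume : Measure ℝ)) :
    σ.Z K (F - G) = σ.Z K F - σ.Z K G := by
  unfold TimeSeq.Z
  rw [← (hlam.summable_Z hK hT F).tsum_sub (hlam.summable_Z hK hT G)]
  refine tsum_congr fun n => ?_
  rw [← sub_smul, ← intervalIntegral.integral_sub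
    (MemLp.intervalIntegrable_of_two (Lp.memLp F) _ _)
    (MemLp.intervalIntegrable_of_two (Lp.memLp G) _ _)]
  congr 1
  exact intervalIntegral.integral_congr_ae
    ((Lp.coeFn_sub F G).mono fun x hx _ => by rw [hx, Pi.sub_apply])

/-- The contraction estimate `‖f - PZf‖ ≤ (T/τ) ‖f‖` on `V²(λ)`. -/
theorem IsGenerator.norm_sub_starProjection_Z_le (hlam : lam.IsGenerator)
    [lam.V2L.HasOrthogonalProjection] (hK : lam.IsReproducingKernel K) (hT0 : 0 ≤ T)
    (hT : σ.IsDense T) {F : Lp ℝ 2 (volume : Measure ℝ)} (hF : F ∈ lam.V2L) :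
    ‖F - lam.V2L.starProjection (σ.Z K F)‖ ≤ T / lam.tau.toReal * ‖F‖ := by
  have hτ : 0 < lam.tau.toReal := ENNReal.toReal_pos hlam.tau_pos.ne' hlam.tau_lt_top.ne
  set E := F - lam.V2L.starProjection (σ.Z K F) with hE
  have hEm : E ∈ lam.V2L := lam.V2L.sub_mem hF (Submodule.starProjection_apply_mem _ _)
  obtain ⟨f, hf, hEf⟩ := id hEm
  obtain ⟨D, hD, hDE⟩ := hlam.exists_deriv hf hEf
  have hc := continuous_of_sub_eq_integral hD
  have hfL : MemLp f 2 (volume : Measure ℝ) := hlam.memLp_of_mem_V2 hf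
  set d : ℤ → ℝ := fun n => ∫ x in σ.t n..σ.t (n + 1), F x * (f x - f (σ.s (n + 1))) with hd
  have h1 : HasSum d (‖E‖ ^ 2) := by
    have e1 : ‖E‖ ^ 2 = (∫ x, F x * f x) - inner ℝ E (σ.Z K F) := by
      rw [← real_inner_self_eq_norm_sq]
      nth_rw 2 [hE]
      rw [inner_sub_right, ← Submodule.inner_starProjection_left_eq_right,
        Submodule.starProjection_eq_self_iff.2 hEm]
      congr 1
      rw [L2.inner_def]
      refine integral_congr_ae (hEf.mono fun x hx => ?_)
      simp [hx]
    -- Pairing with `E` turns each kernel into the value of `f` at the midpoint.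
    have e2 : HasSum (fun n => (∫ u in σ.t n..σ.t (n + 1), F u) * f (σ.s (n + 1)))
        (inner ℝ E (σ.Z K F)) := by
      have := (hlam.summable_Z hK hT F).hasSum.mapL (innerSL ℝ E)
      simp only [innerSL_apply_apply, inner_smul_right, ← (hK _).2 f hf E hEf] at this
      exact this
    have hFf : Integrable (fun x => F x * f x) := (Lp.memLp F).integrable_mul hfL
    have e4 : d = fun n => (∫ x in σ.t n..σ.t (n + 1), F x * f x) -
        (∫ u in σ.t n..σ.t (n + 1), F u) * f (σ.s (n + 1)) := by
      funext n
      simp only [hd, mul_sub]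
      rw [intervalIntegral.integral_sub hFf.intervalIntegrable
        ((MemLp.intervalIntegrable_of_two (Lp.memLp F) _ _).mul_const _),
        intervalIntegral.integral_mul_const]
    rw [e1, e4]
    exact (σ.hasSum_integral hFf).sub e2
  -- Cauchy–Schwarz on each interval, Wirtinger for f − f(sₙ₊₁), then Cauchy–Schwarz over the
  -- intervals.
  have h2 : ∀ s : Finset ℤ, (∑ n ∈ s, d n) ^ 2 ≤ ‖F‖ ^ 2 * ((T / Real.pi) ^ 2 * ‖D‖ ^ 2) := by
    intro s
    have h0 : ∀ n, σ.t n ≤ σ.t (n + 1) := fun n => (σ.strictMono (lt_add_one _)).le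
    calc (∑ n ∈ s, d n) ^ 2 ≤ (∑ n ∈ s, ∫ x in σ.t n..σ.t (n + 1), F x ^ 2) *
          ∑ n ∈ s, (T / Real.pi) ^ 2 * ∫ x in σ.t n..σ.t (n + 1), D x ^ 2 := by
          refine Finset.sum_sq_le_sum_mul_sum_of_sq_le_mul s (fun n _ => ?_) (fun n _ => ?_)
            fun n _ => ?_
          · exact intervalIntegral.integral_nonneg (h0 n) fun _ _ => sq_nonneg _
          · exact mul_nonneg (sq_nonneg _)
              (intervalIntegral.integral_nonneg (h0 n) fun _ _ => sq_nonneg _)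
          · refine le_trans ?_ (mul_le_mul_of_nonneg_left (integral_sq_sub_sample_le hT hD n)
              (intervalIntegral.integral_nonneg (h0 n) fun _ _ => sq_nonneg _))
            simp only [hd, intervalIntegral.integral_of_le (h0 n)]
            refine sq_integral_mul_le ((Lp.memLp F).restrict _) ?_
            exact (hfL.restrict _).sub (memLp_const _)
      _ ≤ _ := by
          rw [← Finset.mul_sum]
          have := TimeSeq.sum_integral_sq_le (σ := σ) F s
          have := TimeSeq.sum_integral_sq_le (σ := σ) D s
          have : 0 ≤ ∑ n ∈ s, ∫ x in σ.t n..σ.t (n + 1), D x ^ 2 := Finset.sum_nonneg fun n _ =>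
            intervalIntegral.integral_nonneg (h0 n) fun _ _ => sq_nonneg _
          gcongr
  have h3 : (‖E‖ ^ 2) ^ 2 ≤ ‖F‖ ^ 2 * ((T / Real.pi) ^ 2 * ‖D‖ ^ 2) :=
    le_of_tendsto' (h1.pow 2) h2
  have h4 : ‖E‖ ^ 2 ≤ ‖F‖ * (T / Real.pi * ‖D‖) := by
    rw [← pow_le_pow_iff_left₀ (by positivity) (by positivity) two_ne_zero]
    linarith [h3, mul_pow ‖F‖ (T / Real.pi * ‖D‖) 2, mul_pow (T / Real.pi) ‖D‖ 2]
  have h5 : T / Real.pi * ‖D‖ ≤ T / lam.tau.toReal * ‖E‖ := by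
    have : ‖D‖ ≤ Real.pi / lam.tau.toReal * ‖E‖ := by
      rw [div_mul_eq_mul_div, le_div_iff₀ hτ]; linarith
    calc T / Real.pi * ‖D‖ ≤ T / Real.pi * (Real.pi / lam.tau.toReal * ‖E‖) := by gcongr
      _ = _ := by field_simp
  rcases (norm_nonneg E).eq_or_lt with h6 | h6
  · rw [← h6]; positivity
  · refine le_of_mul_le_mul_right ?_ h6
    calc ‖E‖ * ‖E‖ = ‖E‖ ^ 2 := by ring
      _ ≤ ‖F‖ * (T / lam.tau.toReal * ‖E‖) := h4.trans (by gcongr)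
      _ = _ := by ring

end SobolevH1

/-! ### Decoding and iterative reconstruction -/

theorem TEM.Z_eq_tsum_testRule {S : Set (ℝ → ℝ)} {𝒯 : TEM S} {Φ : TestRule}
    (h : 𝒯.IsIntegrateAndFire Φ) (K : ℝ → Lp ℝ 2 (volume : Measure ℝ)) (f : S)
    {F : Lp ℝ 2 (volume : Measure ℝ)} (hF : F =ᵐ[volume] (f : ℝ → ℝ)) :
    (𝒯 f).Z K F =
      ∑' n : ℤ, Φ (n + 1) ((𝒯 f).past (n + 1)) ((𝒯 f).t (n + 1)) • K ((𝒯 f).s (n + 1)) := by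
  refine tsum_congr fun n => ?_
  rw [← (h f (n + 1)).1, add_sub_cancel_right,
    intervalIntegral.integral_congr_ae (hF.mono fun x hx _ => hx)]

namespace SobolevH1

variable {lam : SobolevH1} {K : ℝ → Lp ℝ 2 (volume : Measure ℝ)} {σ : TimeSeq} {T : ℝ}

theorem IsGenerator.div_tau_lt_one (hlam : lam.IsGenerator) (hT0 : 0 ≤ T)
    (hT : ENNReal.ofReal T < lam.tau) :
    T / lam.tau.toReal < 1 := by
  have hτ : 0 < lam.tau.toReal := ENNReal.toReal_pos hlam.tau_pos.ne' hlam.tau_lt_top.ne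
  rw [div_lt_one hτ]
  exact (ENNReal.ofReal_lt_iff_lt_toReal hT0 hlam.tau_lt_top.ne).1 hT

/-- A signal of `V²(λ)` is determined by its samples `Z f`. -/
theorem IsGenerator.eq_of_Z_eq (hlam : lam.IsGenerator) [lam.V2L.HasOrthogonalProjection]
    (hK : lam.IsReproducingKernel K) (hT0 : 0 ≤ T) (hTτ : ENNReal.ofReal T < lam.tau)
    (hT : σ.IsDense T) {F G : Lp ℝ 2 (volume : Measure ℝ)} (hF : F ∈ lam.V2L) (hG : G ∈ lam.V2L)
    (h : σ.Z K F = σ.Z K G) : F = G := by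
  have h1 := hlam.norm_sub_starProjection_Z_le hK hT0 hT (lam.V2L.sub_mem hF hG)
  -- Since Z(F − G) = 0, the contraction estimate reads ‖F − G‖ ≤ (T/τ)‖F − G‖.
  rw [hlam.Z_sub hK hT, h, sub_self, map_zero, sub_zero] at h1
  have h2 := hlam.div_tau_lt_one hT0 hTτ
  have h3 : ‖F - G‖ = 0 := by nlinarith [norm_nonneg (F - G)]
  exact sub_eq_zero.1 (norm_eq_zero.1 h3)

/-- The error satisfies G − F (k + 1) = (Id − PZ)(G − F k). Membership in `V2L` is part of the
induction because the contraction holds there. -/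
theorem IsGenerator.norm_sub_iterate_le (hlam : lam.IsGenerator)
    [lam.V2L.HasOrthogonalProjection] (hK : lam.IsReproducingKernel K) (hT0 : 0 ≤ T)
    (hT : σ.IsDense T) {G : Lp ℝ 2 (volume : Measure ℝ)} (hG : G ∈ lam.V2L)
    {F : ℕ → Lp ℝ 2 (volume : Measure ℝ)} (h1 : F 1 = lam.V2L.starProjection (σ.Z K G))
    (hF : ∀ k : ℕ, 1 ≤ k → F (k + 1) = F 1 + (F k - lam.V2L.starProjection (σ.Z K (F k))))
    {k : ℕ} (hk : 1 ≤ k) :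
    F k ∈ lam.V2L ∧ ‖G - F k‖ ≤ (T / lam.tau.toReal) ^ k * ‖G‖ := by
  induction k, hk using Nat.le_induction with
  | base =>
    rw [h1, pow_one]
    exact ⟨Submodule.starProjection_apply_mem _ _, hlam.norm_sub_starProjection_Z_le hK hT0 hT hG⟩
  | succ k hk ih =>
    rw [hF k hk, h1]
    refine ⟨lam.V2L.add_mem (Submodule.starProjection_apply_mem _ _)
      (lam.V2L.sub_mem ih.1 (Submodule.starProjection_apply_mem _ _)), ?_⟩
    have h2 : G - (lam.V2L.starProjection (σ.Z K G) +
        (F k - lam.V2L.starProjection (σ.Z K (F k)))) =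
        (G - F k) - lam.V2L.starProjection (σ.Z K (G - F k)) := by
      rw [hlam.Z_sub hK hT, map_sub]; abel
    rw [h2, pow_succ', mul_assoc]
    exact (hlam.norm_sub_starProjection_Z_le hK hT0 hT (lam.V2L.sub_mem hG ih.1)).trans
      (mul_le_mul_of_nonneg_left ih.2 (by positivity))

end SobolevH1

end

theorem theorem2 (lam : SobolevH1) (hlam : lam.IsGenerator) :
    0 < lam.tau ∧ lam.tau < ⊤ ∧
    ∃ (hV : ∀ f ∈ lam.V2, MemLp f 2 (volume : Measure ℝ))
      (_ : lam.V2L.HasOrthogonalProjection)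
      (K : ℝ → Lp ℝ 2 (volume : Measure ℝ)),
      lam.IsReproducingKernel K ∧
      ∀ T : ℝ, ENNReal.ofReal T < lam.tau →
      ∀ (S : Set (ℝ → ℝ)) (hS : S ⊆ lam.V2), S.Nonempty →
      ∀ (𝒯 : TEM S) (Φ : TestRule), 𝒯.IsIntegrateAndFire Φ → 𝒯.IsDense T →
        𝒯.IsInvertible ∧
        ∀ f : S,
          -- the series defining `Z` converges on `V²(λ)`
          (∀ g ∈ lam.V2L, Summable fun n : ℤ =>
            (∫ u in (𝒯 f).t n..(𝒯 f).t (n + 1), g u) • K ((𝒯 f).s (n + 1))) ∧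
          -- `Z f` is determined by the output of the machine
          (𝒯 f).Z K (hV f (hS f.2)).toLp =
            ∑' n : ℤ, Φ (n + 1) ((𝒯 f).past (n + 1)) ((𝒯 f).t (n + 1)) • K ((𝒯 f).s (n + 1)) ∧
          -- iterative reconstruction
          ∀ F : ℕ → Lp ℝ 2 (volume : Measure ℝ),
            F 1 = lam.V2L.starProjection ((𝒯 f).Z K (hV f (hS f.2)).toLp) →
            (∀ k : ℕ, 1 ≤ k →
              F (k + 1) = F 1 + (F k - lam.V2L.starProjection ((𝒯 f).Z K (F k)))) →
            (∀ k : ℕ, 1 ≤ k →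
              ‖(hV f (hS f.2)).toLp - F k‖
                ≤ (T / lam.tau.toReal) ^ k * ‖(hV f (hS f.2)).toLp‖) ∧
            Tendsto F atTop (𝓝 (hV f (hS f.2)).toLp) := by
  have hV : ∀ f ∈ lam.V2, MemLp f 2 (volume : Measure ℝ) := fun f hf => hlam.memLp_of_mem_V2 hf
  have : CompleteSpace lam.V2L := hlam.isComplete_V2L.completeSpace_coe
  have hP : lam.V2L.HasOrthogonalProjection := inferInstance
  obtain ⟨K, hK⟩ := hlam.exists_isReproducingKernel
  refine ⟨hlam.tau_pos, hlam.tau_lt_top, hV, hP, K, hK, ?_⟩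
  intro T hTτ S hS hne 𝒯 Φ hΦ hT
  -- `ENNReal.ofReal` sends negative T to 0, so the sign of T must come from a positive gap in some
  -- output; this needs `S` nonempty.
  have hT0 : 0 ≤ T := by
    obtain ⟨f, hf⟩ := hne
    have h1 := hT ⟨f, hf⟩ 0
    have h2 := (𝒯 ⟨f, hf⟩).strictMono (lt_add_one (0 : ℤ))
    linarith
  have hmem : ∀ f : S, (hV f (hS f.2)).toLp ∈ lam.V2L := fun f =>
    ⟨f, hS f.2, (hV f (hS f.2)).coeFn_toLp⟩
  have hZ : ∀ f : S, (𝒯 f).Z K (hV f (hS f.2)).toLp =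
      ∑' n : ℤ, Φ (n + 1) ((𝒯 f).past (n + 1)) ((𝒯 f).t (n + 1)) • K ((𝒯 f).s (n + 1)) := fun f =>
    TEM.Z_eq_tsum_testRule hΦ K f (hV f (hS f.2)).coeFn_toLp
  refine ⟨?_, fun f => ⟨fun g _ => hlam.summable_Z hK (hT f) g, hZ f, fun F h1 hF => ?_⟩⟩
  · have : Nonempty S := hne.to_subtype
    have hinj : Function.Injective 𝒯 := by
      intro f g hfg
      have h1 := hZ f
      rw [hfg, ← hZ g] at h1
      have h2 := hlam.eq_of_Z_eq hK hT0 hTτ (hT g) (hmem f) (hmem g) h1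
      exact Subtype.ext (hlam.eq_of_ae_eq (hS f.2) (hS g.2)
        ((MemLp.toLp_eq_toLp_iff _ _).1 h2))
    exact ⟨Function.invFun 𝒯, Function.leftInverse_invFun hinj⟩
  · have h2 : ∀ k : ℕ, 1 ≤ k → ‖(hV f (hS f.2)).toLp - F k‖
        ≤ (T / lam.tau.toReal) ^ k * ‖(hV f (hS f.2)).toLp‖ := fun k hk =>
      (hlam.norm_sub_iterate_le hK hT0 (hT f) (hmem f) h1 hF hk).2
    refine ⟨h2, tendsto_iff_norm_sub_tendsto_zero.2 ?_⟩
    have h3 := (tendsto_pow_atTop_nhds_zero_of_lt_one (div_nonneg hT0 ENNReal.toReal_nonneg)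
      (hlam.div_tau_lt_one hT0 hTτ)).mul_const ‖(hV f (hS f.2)).toLp‖
    rw [zero_mul] at h3
    -- The bound holds only from k = 1 on, as `F 0` is arbitrary.
    refine squeeze_zero' (Eventually.of_forall fun _ => norm_nonneg _) ?_ h3
    filter_upwards [eventually_ge_atTop 1] with k hk
    rw [norm_sub_rev]
    exact h2 k hk
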